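/- **Setting.** Let $0<\alpha\le 1$, let $k\ge 1$ be an integer, and let $\lambda_1,\dots,\lambda_k>0$ and $\mu_1,\dots,\mu_k>0$. A *generalized counting process* with rates $\lambda_1,\dots,\lambda_k$ is an $\mathbb{N}_0$-valued Lévy process $M$ (started at $0$) with $$\Pr\{M(t+h)=n\mid M(t)=m\}=\begin{cases}1-(\lambda_1+\dots+\lambda_k)h+o(h), & n=m,\\ \lambda_j h+o(h), & n=m+j,\ 1\le j\le k,\\ o(h), & n>m+k,\end{cases}\qquad h\downarrow 0.$$ Let $M_1,M_2$ be independent generalized counting processes with rates $(\lambda_j)$ and $(\mu_j)$, and let $\mathcal S(t)=M_1(t)-M_2(t)$ be the generalized Skellam process. For $0<\alpha<1$ let $D_\alpha$ be an $\alpha$-stable subordinator, $\mathbb E\,e^{-sD_\alpha(t)}=e^{-ts^\alpha}$, let $Y_\alpha(t)=\inf\{x\ge0: D_\alpha(x)>t\}$ be its inverse, assumed independent of $\mathcal S$, and put $\mathcal S^\alpha(t)=\mathcal S(Y_\alpha(t))$; for $\alpha=1$ put $\mathcal S^1(t)=\mathcal S(t)$. Let $D_f$ be a Lévy subordinator (a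 real Lévy process with $D_f(0)=0$ a.s. and non-decreasing paths) that is independent of $\mathcal S^\alpha$ and satisfies $\mathbb E[D_f(t)^r]<\infty$ for all $r>0$ and $t\ge 0$. Put $$\mathcal Z_f^\alpha(t)=\mathcal S^\alpha(D_f(t)),\qquad g(u)=\sum_{j=1}^k\big(\lambda_j(u^j-1)+\mu_j(u^{-j}-1)\big)\quad(u\neq0).$$ **Theorem.** For every $t\ge0$, the probability generating function of $\mathcal Z_f^\alpha(t)$ is $$\mathbb E\big(u^{\mathcal Z_f^\alpha(t)}\big)=\sum_{n=0}^\infty \frac{g(u)^n}{\Gamma(n\alpha+1)}\,\mathbb E\big[D_f(t)^{n\alpha}\big],\qquad 0<|u|\le1,\tag{$*$}$$ in the following sense. 1. For every complex $u$ with $0<|u|\le1$ for which both sides exist, i.e. $\mathbb E\,|u|^{\mathcal Z_f^\alpha(t)}<\infty$ and the partial sums of the series converge, $(*)$ holds. 2. The left-hand side exists ($\mathbb E\,|u|^{\mathcal Z_f^\alpha(t)}<\infty$) for every complex $u$ with $|u|=1$, and for every real $u\in(0,1]$ with $g(u)\le 0$. 3. For every real $u\in(0,1]$ with $g(u)\ge0$,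 $(*)$ holds without further conditions as an equality in $[0,\infty]$; in particular, one side is finite if and only if the other is. -/

import Mathlib

open MeasureTheory ProbabilityTheory Filter Topology Asymptotics
open scoped NNReal ENNReal

noncomputable section

namespace TimeChangedSkellam

/-- A path indexed by `[0, ∞)` is càdlàg: right-continuous, with left limits. -/
def IsCadlag {E : Type*} [TopologicalSpace E] (x : ℝ≥0 → E) : Prop :=
  ∀ t, ContinuousWithinAt x (Set.Ici t) t ∧ ∃ l, Tendsto x (𝓝[<] t) (𝓝 l)

/-- Lévy process: it starts at `0` almost surely, has independent and stationary increments, and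
almost all of its paths are càdlàg (so that it is continuous in probability). -/
structure IsLevyProcess {Ω E : Type*} [MeasurableSpace Ω] [TopologicalSpace E] [MeasurableSpace E]
    [AddGroup E] (X : ℝ≥0 → Ω → E) (P : Measure Ω) : Prop where
  measurable : ∀ t, Measurable (X t)
  zero : ∀ᵐ ω ∂P, X 0 ω = 0
  indep : HasIndepIncrements X P
  stationary : ∀ s t, IdentDistrib (fun ω => X (s + t) ω - X s ω) (X t) P P
  cadlag : ∀ᵐ ω ∂P, IsCadlag (fun t => X t ω)

/-- Generalized counting process with rates `lam 1, …, lam k`: a Lévy process with values in `ℕ`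
which, in a time interval of length `h`, jumps by `j ∈ {1, …, k}` with probability
`lam j * h + o(h)`, stays put with probability `1 - (lam 1 + ⋯ + lam k) * h + o(h)`, and jumps by
any given `n > k` with probability `o(h)`. The transition probabilities
`Pr {M (t + h) = n | M t = m}` are considered at the states `m` with `Pr {M t = m} ≠ 0`. -/
structure IsGCP {Ω : Type*} [MeasurableSpace Ω] (k : ℕ) (lam : ℕ → ℝ) (M : ℝ≥0 → Ω → ℕ)
    (P : Measure Ω) : Prop where
  levy : IsLevyProcess (fun t ω => (M t ω : ℤ)) P
  stay : ∀ t m, P (M t ⁻¹' {m}) ≠ 0 →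
    (fun h : ℝ≥0 => (P[|M t ⁻¹' {m}]).real (M (t + h) ⁻¹' {m})
      - (1 - (∑ j ∈ Finset.Icc 1 k, lam j) * (h : ℝ))) =o[𝓝[>] 0] fun h : ℝ≥0 => (h : ℝ)
  jump : ∀ t m, P (M t ⁻¹' {m}) ≠ 0 → ∀ j ∈ Finset.Icc 1 k,
    (fun h : ℝ≥0 => (P[|M t ⁻¹' {m}]).real (M (t + h) ⁻¹' {m + j}) - lam j * (h : ℝ))
      =o[𝓝[>] 0] fun h : ℝ≥0 => (h : ℝ)
  large : ∀ t m, P (M t ⁻¹' {m}) ≠ 0 → ∀ n, m + k < n →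
    (fun h : ℝ≥0 => (P[|M t ⁻¹' {m}]).real (M (t + h) ⁻¹' {n}))
      =o[𝓝[>] 0] fun h : ℝ≥0 => (h : ℝ)

/-- Lévy subordinator: a real Lévy process with almost surely non-decreasing paths. -/
structure IsSubordinator {Ω : Type*} [MeasurableSpace Ω] (D : ℝ≥0 → Ω → ℝ) (P : Measure Ω) :
    Prop where
  levy : IsLevyProcess D P
  mono : ∀ᵐ ω ∂P, Monotone fun t => D t ω

/-- `α`-stable subordinator: the subordinator with Laplace exponent `s ↦ s ^ α`. -/
structure IsStableSubordinator {Ω : Type*} [MeasurableSpace Ω] (α : ℝ) (A : ℝ≥0 → Ω → ℝ)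
    (P : Measure Ω) : Prop where
  subordinator : IsSubordinator A P
  laplace : ∀ (t : ℝ≥0) (s : ℝ), 0 < s →
    ∫ ω, Real.exp (-s * A t ω) ∂P = Real.exp (-(t : ℝ) * s ^ α)

/-- First passage time `inf {x ≥ 0 : A x > t}`. -/
def firstPassage {Ω : Type*} (A : ℝ≥0 → Ω → ℝ) (t : ℝ≥0) (ω : Ω) : ℝ≥0 :=
  sInf {x : ℝ≥0 | (t : ℝ) < A x ω}

/-- The difference `M₁ - M₂`; this is the generalized Skellam process when `M₁` and `M₂` are
independent generalized counting processes. -/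
def skellam {Ω : Type*} (M₁ M₂ : ℝ≥0 → Ω → ℕ) (t : ℝ≥0) (ω : Ω) : ℤ :=
  (M₁ t ω : ℤ) - (M₂ t ω : ℤ)

open Classical in
/-- Generalized fractional Skellam process built from `S` and a stable subordinator `A`: it is
`S (Y t)` with `Y` the first passage time process of `A` if `0 < α < 1`, and `S t` if `α = 1`. -/
def gfsp {Ω : Type*} (α : ℝ) (S : ℝ≥0 → Ω → ℤ) (A : ℝ≥0 → Ω → ℝ) (t : ℝ≥0) (ω : Ω) : ℤ :=
  if α < 1 then S (firstPassage A t ω) ω else S t ω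

/-- The process `X` time-changed by `D`, that is `X (D t)`. (A subordinator is almost surely
nonnegative, so that `Real.toNNReal` only adjusts the type.) -/
def timeChange {Ω : Type*} (X : ℝ≥0 → Ω → ℤ) (D : ℝ≥0 → Ω → ℝ) (t : ℝ≥0) (ω : Ω) : ℤ :=
  X (D t ω).toNNReal ω

/-- `∑_{j=1}^k (lam j * (u ^ j - 1) + mu j * (u ^ (-j) - 1))`. -/
def symbol {𝕜 : Type*} [RCLike 𝕜] (k : ℕ) (lam mu : ℕ → ℝ) (u : 𝕜) : 𝕜 :=
  ∑ j ∈ Finset.Icc 1 k,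
    ((lam j : 𝕜) * (u ^ j - 1) + (mu j : 𝕜) * (u ^ (-(j : ℤ)) - 1))

/-- `E[(D t) ^ (n α)] / Γ(n α + 1)`. -/
def coeff {Ω : Type*} [MeasurableSpace Ω] (P : Measure Ω) (α : ℝ) (D : ℝ≥0 → Ω → ℝ) (t : ℝ≥0)
    (n : ℕ) : ℝ :=
  (∫ ω, D t ω ^ ((n : ℝ) * α) ∂P) / Real.Gamma ((n : ℝ) * α + 1)

end TimeChangedSkellam

end

namespace TimeChangedSkellam

/-! Condition on the clock. With ρ the law of D_f(t), E u^Z is the ρ-integral of E u^{S^α(s)}, which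
equals the Mittag-Leffler value E_α(g(u) s^α): for α = 1 because the Skellam generating function is
exp(g(u) s), for α < 1 because Y_α(s) has moments n! s^{nα}/Γ(nα+1). It remains to exchange the
Mittag-Leffler series with the integral over ρ.

If g(u) ≥ 0 this is Tonelli. For complex u the series may converge only conditionally, and Abel
summation replaces absolute convergence (`IsMixture.integral_fracExp_eq_of_tendsto`): at r g(u) with
0 < r < 1 the terms decay geometrically and the exchange is legitimate; as r → 1 the series
converges by Abel's theorem and the integral by dominated convergence. The dominating function 1 +
E_α(g(|u|) s^α) comes from writing E_α as the Laplace transform of a probability measure and from Re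
g(u) ≤ g(|u|); its integrability is exactly E|u|^Z < ∞.

The inputs are `map_randomTime` (conditioning on an independent time), `IsGCP.generatingFunction`
(obtained from the small-time rates, then continued beyond the unit disc because u⁻¹ is needed too)
and `IsStableSubordinator.lintegral_firstPassage_pow` (moments by self-similarity). -/

/-! ### Mittag-Leffler series and Abel summation -/

theorem rpow_mul_exp_neg_le_Gamma {q R : ℝ} (hq : 0 ≤ q) (hR : 0 < R) :
    R ^ q * Real.exp (-R) ≤ Real.Gamma (q + 1) := by
  have hint : IntegrableOn (fun x => Real.exp (-x) * x ^ q) (Set.Ioi 0) := by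
    simpa using Real.GammaIntegral_convergent (s := q + 1) (by linarith)
  have hsub : Set.Ioi R ⊆ Set.Ioi (0 : ℝ) := Set.Ioi_subset_Ioi hR.le
  -- Euler's integral cut down to x > R, where x^q ≥ R^q.
  calc R ^ q * Real.exp (-R) = ∫ x in Set.Ioi R, Real.exp (-x) * R ^ q := by
        rw [integral_mul_const, integral_exp_neg_Ioi, mul_comm]
    _ ≤ ∫ x in Set.Ioi R, Real.exp (-x) * x ^ q := by
        refine setIntegral_mono_on ((integrableOn_exp_neg_Ioi R).mul_const _)
          (hint.mono_set hsub) measurableSet_Ioi fun x hx => ?_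
        have : R ≤ x := le_of_lt hx
        gcongr
    _ ≤ ∫ x in Set.Ioi (0 : ℝ), Real.exp (-x) * x ^ q := by
        refine setIntegral_mono_set hint ?_ hsub.eventuallyLE
        filter_upwards [ae_restrict_mem measurableSet_Ioi] with x hx
        have : 0 < x := hx
        positivity
    _ = Real.Gamma (q + 1) := by
        rw [Real.Gamma_eq_integral (by linarith)]
        simp

/-- The weights `s ^ (n α) / Γ (n α + 1)` of the fractional exponential series. -/
noncomputable def fracCoeff (α : ℝ) (s : ℝ≥0) (n : ℕ) : ℝ :=
  (s : ℝ) ^ ((n : ℝ) * α) / Real.Gamma ((n : ℝ) * α + 1)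

/-- The Mittag-Leffler function `E_α (z s ^ α)`. -/
noncomputable def fracExp {𝕜 : Type*} [RCLike 𝕜] (α : ℝ) (z : 𝕜) (s : ℝ≥0) : 𝕜 :=
  ∑' n : ℕ, z ^ n * (fracCoeff α s n : 𝕜)

theorem Gamma_mul_add_one_pos {α : ℝ} (hα : 0 < α) (n : ℕ) :
    0 < Real.Gamma ((n : ℝ) * α + 1) :=
  Real.Gamma_pos_of_pos (by positivity)

theorem fracCoeff_nonneg {α : ℝ} (hα : 0 < α) (s : ℝ≥0) (n : ℕ) : 0 ≤ fracCoeff α s n :=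
  div_nonneg (by positivity) (Gamma_mul_add_one_pos hα n).le

theorem measurable_fracCoeff (α : ℝ) (n : ℕ) : Measurable fun s => fracCoeff α s n := by
  unfold fracCoeff
  fun_prop

theorem summable_pow_mul_fracCoeff {α : ℝ} (hα : 0 < α) {x : ℝ} (hx : 0 ≤ x) (s : ℝ≥0) :
    Summable fun n => x ^ n * fracCoeff α s n := by
  set y : ℝ := x * (s : ℝ) ^ α with hy
  have hy0 : 0 ≤ y := by positivity
  -- R is chosen with R^α = 2y + 1, so that Γ(nα+1) ≥ (2y+1)^n e^{-R} and the series is dominated by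
  -- a geometric one of ratio y/(2y+1) < 1.
  set R : ℝ := (2 * y + 1) ^ (1 / α) with hR
  have hR0 : 0 < R := by positivity
  have hRα : R ^ α = 2 * y + 1 := by
    rw [hR, ← Real.rpow_mul (by positivity), one_div_mul_cancel hα.ne', Real.rpow_one]
  have hgeo : Summable fun n : ℕ => Real.exp R * (y / (2 * y + 1)) ^ n :=
    (summable_geometric_of_lt_one (by positivity)
      ((div_lt_one (by positivity)).2 (by linarith))).mul_left _
  refine hgeo.of_nonneg_of_le (fun n => mul_nonneg (by positivity) (fracCoeff_nonneg hα s n))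
    fun n => ?_
  have h1 : x ^ n * fracCoeff α s n = y ^ n / Real.Gamma ((n : ℝ) * α + 1) := by
    rw [fracCoeff, hy, mul_pow, ← Real.rpow_natCast ((s : ℝ) ^ α), ← Real.rpow_mul (by positivity),
      mul_comm α, mul_div_assoc]
  have h2 := rpow_mul_exp_neg_le_Gamma (q := n * α) (by positivity) hR0
  have h3 : R ^ ((n : ℝ) * α) = (2 * y + 1) ^ n := by
    rw [mul_comm, Real.rpow_mul hR0.le, hRα, Real.rpow_natCast]
  rw [h3] at h2
  calc x ^ n * fracCoeff α s n = y ^ n / Real.Gamma ((n : ℝ) * α + 1) := h1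
    _ ≤ y ^ n / ((2 * y + 1) ^ n * Real.exp (-R)) := by gcongr
    _ = Real.exp R * (y / (2 * y + 1)) ^ n := by
        rw [Real.exp_neg, div_pow]
        field_simp

theorem summable_norm_pow_mul_fracCoeff {𝕜 : Type*} [RCLike 𝕜] {α : ℝ} (hα : 0 < α) (z : 𝕜)
    (s : ℝ≥0) : Summable fun n => ‖z ^ n * (fracCoeff α s n : 𝕜)‖ := by
  simpa [abs_of_nonneg (fracCoeff_nonneg hα s _)]
    using summable_pow_mul_fracCoeff hα (norm_nonneg z) s

theorem hasSum_fracExp {𝕜 : Type*} [RCLike 𝕜] {α : ℝ} (hα : 0 < α) (z : 𝕜)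
    (s : ℝ≥0) : HasSum (fun n => z ^ n * (fracCoeff α s n : 𝕜)) (fracExp α z s) :=
  (summable_norm_pow_mul_fracCoeff hα z s).of_norm.hasSum

theorem fracExp_ofReal (α : ℝ) (x : ℝ) (s : ℝ≥0) :
    fracExp α (x : ℂ) s = (fracExp α x s : ℝ) := by
  simp [fracExp, Complex.ofReal_tsum]

theorem measurable_fracExp {𝕜 : Type*} [RCLike 𝕜] {α : ℝ} (hα : 0 < α) (z : 𝕜) :
    Measurable fun s => fracExp α z s := by
  refine measurable_of_tendsto_metrizable (f := fun N s =>
    ∑ n ∈ Finset.range N, z ^ n * (fracCoeff α s n : 𝕜)) (fun N => ?_) ?_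
  · have := measurable_fracCoeff α
    have h2 : ∀ n, Measurable fun s => (fracCoeff α s n : 𝕜) := fun n =>
      RCLike.measurable_ofReal.comp (this n)
    fun_prop
  · exact tendsto_pi_nhds.2 fun s => (hasSum_fracExp hα z s).tendsto_sum_nat

theorem fracExp_one (z : ℂ) (s : ℝ≥0) : fracExp 1 z s = Complex.exp (z * s) := by
  rw [Complex.exp_eq_exp_ℂ, NormedSpace.exp_eq_tsum_div]
  refine tsum_congr fun n => ?_
  simp [fracCoeff, Real.Gamma_nat_eq_factorial, mul_pow, mul_div_assoc]

/-- Every `z ↦ E_α (z s ^ α)` is the Laplace transform of a probability measure on `[0, ∞)`. -/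
def IsMixture (α : ℝ) : Prop :=
  ∀ s : ℝ≥0, ∃ ν : Measure ℝ≥0, IsProbabilityMeasure ν ∧
    ∀ z : ℂ, Integrable (fun y : ℝ≥0 => Complex.exp (z * y)) ν ∧
      ∫ y, Complex.exp (z * y) ∂ν = fracExp α z s

theorem IsMixture.one : IsMixture 1 := fun s =>
  ⟨Measure.dirac s, inferInstance, fun z =>
    ⟨integrable_dirac (by simp), by simp [fracExp_one]⟩⟩

theorem integral_exp_mul_eq_fracExp {α b : ℝ} {s : ℝ≥0} {ν : Measure ℝ≥0}
    (h : ∫ y : ℝ≥0, Complex.exp ((b : ℂ) * y) ∂ν = fracExp α (b : ℂ) s) :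
    ∫ y : ℝ≥0, Real.exp (b * y) ∂ν = fracExp α b s := by
  apply Complex.ofReal_injective
  rw [← fracExp_ofReal, ← h, ← integral_complex_ofReal]
  simp

/-- Under the mixing measure |exp(rzy)| is at most 1 if Re z ≤ 0 and at most exp(by) otherwise. The
sum of the two bounds is uniform in r ∈ [0, 1], as dominated convergence for r → 1 requires. -/
theorem IsMixture.norm_fracExp_le {α : ℝ} (h : IsMixture α) {z : ℂ} {b r : ℝ} (hz : z.re ≤ b)
    (hr0 : 0 ≤ r) (hr1 : r ≤ 1) (s : ℝ≥0) :
    ‖fracExp α ((r : ℂ) * z) s‖ ≤ 1 + fracExp α b s := by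
  obtain ⟨ν, hν, hs⟩ := h s
  have hb : Integrable (fun y : ℝ≥0 => Real.exp (b * y)) ν := by
    refine (hs b).1.norm.congr (ae_of_all _ fun y => ?_)
    simp [Complex.norm_exp]
  have hb' := integral_exp_mul_eq_fracExp (hs b).2
  rw [← (hs _).2]
  calc ‖∫ y : ℝ≥0, Complex.exp ((r : ℂ) * z * y) ∂ν‖
      ≤ ∫ y : ℝ≥0, ‖Complex.exp ((r : ℂ) * z * y)‖ ∂ν := norm_integral_le_integral_norm _
    _ ≤ ∫ y : ℝ≥0, (1 + Real.exp (b * y)) ∂ν := by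
        refine integral_mono (hs _).1.norm ((integrable_const _).add hb) fun y => ?_
        have hre : ((r : ℂ) * z * y).re = r * z.re * y := by
          rw [mul_assoc, Complex.re_ofReal_mul]
          simp [mul_assoc]
        simp only [Complex.norm_exp, hre]
        rcases le_total z.re 0 with h0 | h0
        · have : Real.exp (r * z.re * y) ≤ 1 := by
            rw [Real.exp_le_one_iff]
            exact mul_nonpos_of_nonpos_of_nonneg (mul_nonpos_of_nonneg_of_nonpos hr0 h0) y.2
          have := Real.exp_pos (b * y)
          linarith
        · have : Real.exp (r * z.re * y) ≤ Real.exp (b * y) := by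
            gcongr
            nlinarith
          linarith
    _ = 1 + fracExp α b s := by
        rw [integral_add (integrable_const _) hb, hb']
        simp

theorem IsMixture.fracExp_nonneg {α : ℝ} (h : IsMixture α) (b : ℝ) (s : ℝ≥0) :
    0 ≤ fracExp α b s := by
  obtain ⟨ν, hν, hs⟩ := h s
  have hb' := integral_exp_mul_eq_fracExp (hs b).2
  rw [← hb']
  exact integral_nonneg fun y => (Real.exp_pos _).le

theorem IsMixture.fracExp_le_one {α : ℝ} (h : IsMixture α) {b : ℝ} (hb : b ≤ 0) (s : ℝ≥0) :
    fracExp α b s ≤ 1 := by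
  obtain ⟨ν, hν, hs⟩ := h s
  have hb' := integral_exp_mul_eq_fracExp (hs b).2
  rw [← hb']
  refine (integral_mono_of_nonneg (ae_of_all _ fun y => (Real.exp_pos _).le)
    (integrable_const (1 : ℝ)) (ae_of_all _ fun y => ?_)).trans (by simp)
  exact Real.exp_le_one_iff.2 (mul_nonpos_of_nonpos_of_nonneg hb y.2)

/-- An expectation of Mittag-Leffler functions is the sum of the series of expectations, whenever
that series converges, be it conditionally. -/
theorem IsMixture.integral_fracExp_eq_of_tendsto {α : ℝ} (hα : 0 < α) (h : IsMixture α)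
    {ρ : Measure ℝ≥0} [IsProbabilityMeasure ρ] (hρ : ∀ n, Integrable (fun s => fracCoeff α s n) ρ)
    {z : ℂ} {b : ℝ} (hz : z.re ≤ b) (hb : Integrable (fun s => fracExp α b s) ρ) {l : ℂ}
    (hl : Tendsto (fun N => ∑ n ∈ Finset.range N, z ^ n * ((∫ s, fracCoeff α s n ∂ρ : ℝ) : ℂ))
      atTop (𝓝 l)) :
    ∫ s, fracExp α z s ∂ρ = l := by
  set a : ℕ → ℂ := fun n => z ^ n * ((∫ s, fracCoeff α s n ∂ρ : ℝ) : ℂ) with ha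
  have habel := Complex.tendsto_tsum_powerSeries_nhdsWithin_lt hl
  rw [tendsto_map'_iff] at habel
  -- Convergence, even conditional, bounds the terms; this suffices for geometric domination at
  -- every r < 1.
  have hterm : Tendsto a atTop (𝓝 0) := by
    have := (hl.comp (tendsto_add_atTop_nat 1)).sub hl
    simpa [Finset.sum_range_succ, Function.comp_def] using this
  obtain ⟨C, hC⟩ := hterm.norm.bddAbove_range
  have hC' : ∀ n, ‖a n‖ ≤ C := fun n => hC ⟨n, rfl⟩
  have hIoo : ∀ᶠ r : ℝ in 𝓝[<] 1, r ∈ Set.Ioo (0 : ℝ) 1 := Ioo_mem_nhdsLT one_pos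
  have heq : ∀ r ∈ Set.Ioo (0 : ℝ) 1,
      ∫ s, fracExp α ((r : ℂ) * z) s ∂ρ = ∑' n, a n * (r : ℂ) ^ n := by
    intro r hr
    have hI : ∀ n, Integrable (fun s => ((r : ℂ) * z) ^ n * (fracCoeff α s n : ℂ)) ρ :=
      fun n => (hρ n).ofReal.const_mul _
    have hnorm : ∀ n, ∫ s, ‖((r : ℂ) * z) ^ n * (fracCoeff α s n : ℂ)‖ ∂ρ
        = ‖a n‖ * r ^ n := by
      intro n
      have h0 : 0 ≤ ∫ s, fracCoeff α s n ∂ρ := integral_nonneg fun s => fracCoeff_nonneg hα s n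
      simp only [norm_mul, norm_pow, Complex.norm_real, Real.norm_eq_abs, ha,
        abs_of_nonneg (fracCoeff_nonneg hα _ n), abs_of_nonneg h0, abs_of_pos hr.1]
      rw [integral_const_mul]
      ring
    have hS : Summable fun n => ∫ s, ‖((r : ℂ) * z) ^ n * (fracCoeff α s n : ℂ)‖ ∂ρ := by
      simp only [hnorm]
      refine ((summable_geometric_of_lt_one hr.1.le hr.2).mul_left C).of_nonneg_of_le
        (fun n => mul_nonneg (norm_nonneg _) (pow_nonneg hr.1.le n)) fun n => ?_
      exact mul_le_mul_of_nonneg_right (hC' n) (pow_nonneg hr.1.le n)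
    have := (hasSum_integral_of_summable_integral_norm hI hS).tsum_eq
    change ∫ s, ∑' n, ((r : ℂ) * z) ^ n * (fracCoeff α s n : ℂ) ∂ρ = _
    rw [← this]
    refine tsum_congr fun n => ?_
    rw [integral_const_mul, integral_complex_ofReal, ha]
    ring
  have hlim : Tendsto (fun r : ℝ => ∫ s, fracExp α ((r : ℂ) * z) s ∂ρ) (𝓝[<] 1)
      (𝓝 (∫ s, fracExp α z s ∂ρ)) := by
    refine tendsto_integral_filter_of_dominated_convergence (fun s => 1 + fracExp α b s)
      (Eventually.of_forall fun r => (measurable_fracExp hα _).aestronglyMeasurable) ?_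
      ((integrable_const _).add hb) (ae_of_all _ fun s => ?_)
    · filter_upwards [hIoo] with r hr
      exact ae_of_all _ fun s => h.norm_fracExp_le hz hr.1.le hr.2.le s
    -- Pointwise convergence in s is again Abel's theorem, now for the Mittag-Leffler series itself.
    · have := Complex.tendsto_tsum_powerSeries_nhdsWithin_lt (hasSum_fracExp hα z s).tendsto_sum_nat
      rw [tendsto_map'_iff] at this
      refine this.congr fun r => tsum_congr fun n => ?_
      rw [mul_pow]
      ring_nf
  refine tendsto_nhds_unique hlim (habel.congr' ?_)
  filter_upwards [hIoo] with r hr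
  exact (heq r hr).symm

/-! ### Integer-valued processes at independent random times -/

section TimeChange

variable {Ω : Type*} [MeasurableSpace Ω] {P : Measure Ω} [IsProbabilityMeasure P]

/-- A grid point strictly above `x`, at distance at most `1 / (n + 1)`. -/
noncomputable def gridAbove (n : ℕ) (x : ℝ≥0) : ℝ≥0 := (⌊x * (n + 1)⌋₊ + 1 : ℕ) / (n + 1)

theorem lt_gridAbove (n : ℕ) (x : ℝ≥0) : x < gridAbove n x := by
  rw [gridAbove, lt_div_iff₀ (by positivity)]
  exact_mod_cast Nat.lt_floor_add_one (x * (n + 1))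

theorem gridAbove_le (n : ℕ) (x : ℝ≥0) : gridAbove n x ≤ x + 1 / (n + 1) := by
  have h := Nat.floor_le (zero_le (a := x * (n + 1)))
  rw [gridAbove, div_le_iff₀ (by positivity), add_mul, div_mul_cancel₀ _ (by positivity)]
  push_cast
  gcongr

theorem tendsto_gridAbove (x : ℝ≥0) :
    Tendsto (fun n => gridAbove n x) atTop (𝓝[≥] x) := by
  refine tendsto_nhdsWithin_iff.2 ⟨?_, Eventually.of_forall fun n => (lt_gridAbove n x).le⟩
  refine tendsto_of_tendsto_of_tendsto_of_le_of_le tendsto_const_nhds ?_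
    (fun n => (lt_gridAbove n x).le) (fun n => gridAbove_le n x)
  have : Tendsto (fun n : ℕ => (1 : ℝ≥0) / (n + 1)) atTop (𝓝 0) :=
    tendsto_one_div_add_atTop_nhds_zero_nat
  simpa using this.const_add x

/-- The state space is discrete, so a right limit is eventually attained. -/
theorem eventually_gridAbove_eq {x : ℝ≥0 → ℤ} {t : ℝ≥0}
    (hx : ContinuousWithinAt x (Set.Ici t) t) : ∀ᶠ n in atTop, x (gridAbove n t) = x t := by
  have := (hx.tendsto.comp (tendsto_gridAbove t))
  rw [nhds_discrete, tendsto_pure] at this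
  exact this

theorem tendsto_map_singleton {X : Ω → ℤ} {Xn : ℕ → Ω → ℤ}
    (hXn : ∀ n, AEMeasurable (Xn n) P) (hX : AEMeasurable X P)
    (h : ∀ᵐ ω ∂P, ∀ᶠ n in atTop, Xn n ω = X ω) (m : ℤ) :
    Tendsto (fun n => P.map (Xn n) {m}) atTop (𝓝 (P.map X {m})) := by
  classical
  set f : ℤ → ℝ≥0∞ := Set.indicator {m} 1 with hf
  have hfm : Measurable f := measurable_from_top
  have key : ∀ Y : Ω → ℤ, AEMeasurable Y P → P.map Y {m} = ∫⁻ ω, f (Y ω) ∂P := by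
    intro Y hY
    rw [← lintegral_indicator_one (measurableSet_singleton m),
      lintegral_map' hfm.aemeasurable hY]
  rw [key X hX]
  simp only [key _ (hXn _)]
  refine tendsto_lintegral_of_dominated_convergence' (fun _ => 1)
    (fun n => hfm.comp_aemeasurable (hXn n)) (fun n => ae_of_all _ fun ω => ?_) (by simp) ?_
  · simp only [hf, Set.indicator_apply]
    split_ifs <;> simp
  · filter_upwards [h] with ω hω
    refine tendsto_const_nhds.congr' ?_
    filter_upwards [hω] with n hn
    rw [hn]

/-- Each t ↦ P(X_t = m) is a limit of step functions on the grids, by right-continuity. The marginal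
laws thus form a kernel. -/
theorem measurable_map_of_rightCts {X : ℝ≥0 → Ω → ℤ} (hX : ∀ t, AEMeasurable (X t) P)
    (hr : ∀ᵐ ω ∂P, ∀ t, ContinuousWithinAt (fun s => X s ω) (Set.Ici t) t) :
    Measurable fun t => P.map (X t) := by
  have hsing : ∀ m : ℤ, Measurable fun t => P.map (X t) {m} := by
    intro m
    refine measurable_of_tendsto_metrizable
      (f := fun n t => P.map (X (gridAbove n t)) {m}) (fun n => ?_) ?_
    · have : Measurable fun j : ℕ => P.map (X ((j + 1 : ℕ) / (n + 1))) {m} := measurable_from_top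
      exact this.comp (Nat.measurable_floor.comp (measurable_id.mul_const _))
    · refine tendsto_pi_nhds.2 fun t => tendsto_map_singleton (fun n => hX _) (hX t) ?_ m
      filter_upwards [hr] with ω hω using eventually_gridAbove_eq (hω t)
  refine Measure.measurable_of_measurable_coe _ fun s _ => ?_
  have : ∀ t, P.map (X t) s = ∑' m : s, P.map (X t) {(m : ℤ)} := fun t => by
    conv_lhs => rw [← Set.biUnion_of_singleton s]
    exact measure_biUnion s.to_countable (fun a _ b _ hab => by simpa using hab)
      fun _ _ => measurableSet_singleton _
  simp only [this]
  exact Measurable.tsum fun m => hsing m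

/-- The law of an integer-valued process with right-continuous paths at an independent random
time is the mixture of its marginal laws. -/
theorem map_randomTime {X : ℝ≥0 → Ω → ℤ} (hX : ∀ t, AEMeasurable (X t) P)
    (hr : ∀ᵐ ω ∂P, ∀ t, ContinuousWithinAt (fun s => X s ω) (Set.Ici t) t)
    {τ : Ω → ℝ≥0} (hτ : AEMeasurable τ P) (hind : ∀ t, IndepFun (X t) τ P) :
    AEMeasurable (fun ω => X (τ ω) ω) P ∧
      P.map (fun ω => X (τ ω) ω) = (P.map τ).bind fun t => P.map (X t) := by
  have hmeas := measurable_map_of_rightCts hX hr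
  have hgm : ∀ n, Measurable (gridAbove n) := fun n => by
    have : Measurable fun j : ℕ => (((j + 1 : ℕ) : ℝ≥0) / (n + 1)) := measurable_from_top
    exact this.comp (Nat.measurable_floor.comp (measurable_id.mul_const _))
  have hfl : ∀ n : ℕ, Measurable fun x : ℝ≥0 => ⌊x * (n + 1)⌋₊ := fun n =>
    Nat.measurable_floor.comp (measurable_id.mul_const _)
  have hXn : ∀ n, AEMeasurable (fun ω => X (gridAbove n (τ ω)) ω) P := by
    intro n
    -- At grid times only countably many variables are involved, so all of them can be replaced by
    -- measurable versions off one null set.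
    set G : Ω × ℕ → ℤ := fun p => (hX ((p.2 + 1 : ℕ) / (n + 1))).mk _ p.1
    have hG : Measurable G := 
      measurable_from_prod_countable_left fun j => (hX ((j + 1 : ℕ) / (n + 1))).measurable_mk
    refine ⟨fun ω => G (ω, ⌊hτ.mk τ ω * (n + 1)⌋₊),
      hG.comp (measurable_id.prodMk ((hfl n).comp hτ.measurable_mk)), ?_⟩
    have h2 : ∀ᵐ ω ∂P, ∀ j : ℕ, X ((j + 1 : ℕ) / (n + 1)) ω = G (ω, j) :=
      ae_all_iff.2 fun j => (hX _).ae_eq_mk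
    filter_upwards [hτ.ae_eq_mk, h2] with ω h1 h2
    rw [← h1, ← h2]
    rfl
  have hev : ∀ᵐ ω ∂P, ∀ᶠ n in atTop, X (gridAbove n (τ ω)) ω = X (τ ω) ω := by
    filter_upwards [hr] with ω hω using eventually_gridAbove_eq (hω _)
  have hXτ : AEMeasurable (fun ω => X (τ ω) ω) P := by
    refine aemeasurable_of_tendsto_metrizable_ae atTop hXn ?_
    filter_upwards [hev] with ω hω
    exact tendsto_const_nhds.congr' (hω.mono fun n hn => hn.symm)
  refine ⟨hXτ, Measure.ext_of_singleton fun m => ?_⟩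
  rw [Measure.bind_apply (measurableSet_singleton m) hmeas.aemeasurable]
  have hmm : Measurable fun t => P.map (X t) {m} :=
    (Measure.measurable_coe (measurableSet_singleton m)).comp hmeas
  refine tendsto_nhds_unique (tendsto_map_singleton hXn hXτ hev m) ?_
  -- For a grid-valued time, split according to the countably many grid indices; independence of τ
  -- from each single `X t` factors every piece.
  have hstep : ∀ n, P.map (fun ω => X (gridAbove n (τ ω)) ω) {m}
      = ∫⁻ t, P.map (X (gridAbove n t)) {m} ∂(P.map τ) := by
    intro n
    have hA : AEMeasurable (fun ω => ⌊τ ω * (n + 1)⌋₊) P := (hfl n).comp_aemeasurable hτ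
    calc P.map (fun ω => X (gridAbove n (τ ω)) ω) {m}
        = P ((fun ω => X (gridAbove n (τ ω)) ω) ⁻¹' {m}) :=
          Measure.map_apply_of_aemeasurable (hXn n) (measurableSet_singleton m)
      _ = P (⋃ j : ℕ, (X ((j + 1 : ℕ) / (n + 1)) ⁻¹' {m} ∩
            (fun ω => ⌊τ ω * (n + 1)⌋₊) ⁻¹' {j})) := by
          congr 1
          ext ω
          simp [gridAbove]
      _ = ∑' j : ℕ, P (X ((j + 1 : ℕ) / (n + 1)) ⁻¹' {m} ∩
            (fun ω => ⌊τ ω * (n + 1)⌋₊) ⁻¹' {j}) := by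
          refine measure_iUnion₀ (fun i j hij => ?_) fun j =>
            ((hX _).nullMeasurable (measurableSet_singleton m)).inter
              (hA.nullMeasurable (measurableSet_singleton j))
          refine Disjoint.aedisjoint ?_
          refine Disjoint.mono Set.inter_subset_right Set.inter_subset_right ?_
          exact Disjoint.preimage _ (by simpa using hij)
      _ = ∑' j : ℕ, P.map (X ((j + 1 : ℕ) / (n + 1))) {m} *
            P.map (fun ω => ⌊τ ω * (n + 1)⌋₊) {j} := by
          refine tsum_congr fun j => ?_
          rw [Measure.map_apply_of_aemeasurable (hX _) (measurableSet_singleton m),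
            Measure.map_apply_of_aemeasurable hA (measurableSet_singleton j)]
          exact ((hind _).comp measurable_id (hfl n)).measure_inter_preimage_eq_mul _ _
            (measurableSet_singleton m) (measurableSet_singleton j)
      _ = ∫⁻ j : ℕ, P.map (X ((j + 1 : ℕ) / (n + 1))) {m}
            ∂(P.map (fun ω => ⌊τ ω * (n + 1)⌋₊)) := (lintegral_countable' _).symm
      _ = ∫⁻ t, P.map (X (gridAbove n t)) {m} ∂(P.map τ) := by
          rw [lintegral_map' measurable_from_top.aemeasurable hA,
            lintegral_map' (f := fun t => P.map (X (gridAbove n t)) {m})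
              (hmm.comp (hgm n)).aemeasurable hτ]
          rfl
  simp only [hstep]
  have : IsProbabilityMeasure (P.map τ) := Measure.isProbabilityMeasure_map hτ
  refine tendsto_lintegral_of_dominated_convergence (fun _ => 1)
    (fun n => hmm.comp (hgm n)) (fun n => ae_of_all _ fun t => ?_) (by simp)
    (ae_of_all _ fun t => tendsto_map_singleton (fun n => hX _) (hX t) ?_ m)
  · have := Measure.isProbabilityMeasure_map (hX (gridAbove n t))
    exact prob_le_one
  · filter_upwards [hr] with ω hω using eventually_gridAbove_eq (hω t)

theorem lintegral_randomTime {X : ℝ≥0 → Ω → ℤ} (hX : ∀ t, AEMeasurable (X t) P)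
    (hr : ∀ᵐ ω ∂P, ∀ t, ContinuousWithinAt (fun s => X s ω) (Set.Ici t) t)
    {τ : Ω → ℝ≥0} (hτ : AEMeasurable τ P) (hind : ∀ t, IndepFun (X t) τ P) (f : ℤ → ℝ≥0∞) :
    ∫⁻ ω, f (X (τ ω) ω) ∂P = ∫⁻ t, ∫⁻ ω, f (X t ω) ∂P ∂(P.map τ) := by
  obtain ⟨h1, h2⟩ := map_randomTime hX hr hτ hind
  have hf : Measurable f := measurable_from_top
  rw [← lintegral_map' (μ := P) hf.aemeasurable h1, h2,
    Measure.lintegral_bind (measurable_map_of_rightCts hX hr).aemeasurable hf.aemeasurable]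
  exact lintegral_congr fun t => lintegral_map' hf.aemeasurable (hX t)

theorem integral_randomTime {X : ℝ≥0 → Ω → ℤ} (hX : ∀ t, AEMeasurable (X t) P)
    (hr : ∀ᵐ ω ∂P, ∀ t, ContinuousWithinAt (fun s => X s ω) (Set.Ici t) t)
    {τ : Ω → ℝ≥0} (hτ : AEMeasurable τ P) (hind : ∀ t, IndepFun (X t) τ P) (f : ℤ → ℂ)
    (hf : Integrable (fun ω => f (X (τ ω) ω)) P) :
    ∫ ω, f (X (τ ω) ω) ∂P = ∫ t, ∫ ω, f (X t ω) ∂P ∂(P.map τ) := by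
  obtain ⟨h1, h2⟩ := map_randomTime hX hr hτ hind
  have hm : ∀ μ : Measure ℤ, AEStronglyMeasurable f μ := fun μ =>
    measurable_from_top.aestronglyMeasurable
  let κ : Kernel ℝ≥0 ℤ := ⟨fun t => P.map (X t), measurable_map_of_rightCts hX hr⟩
  have h3 : P.map (fun ω => X (τ ω) ω) = (κ ∘ₖ Kernel.const Unit (P.map τ)) () := by
    rw [h2, Kernel.comp_apply]
    rfl
  have hf' := (integrable_map_measure (hm _) h1).2 hf
  rw [← integral_map h1 (hm _), h3, Kernel.integral_comp (h3 ▸ hf')]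
  exact integral_congr_ae (ae_of_all _ fun t => integral_map (hX t) (hm _))

end TimeChange

/-! ### Generating functions of counting and Skellam processes -/

/-- φ(t) = φ(t/n)^n and n(φ(t/n) - 1) → tG, so the limit (1 + x_n/n)^n → e^x applies; no continuity
of φ away from 0 is needed. -/
theorem eq_exp_of_mul_of_isLittleO {φ : ℝ≥0 → ℂ} {G : ℂ} (h0 : φ 0 = 1)
    (hmul : ∀ s t, φ (s + t) = φ s * φ t)
    (hG : (fun h : ℝ≥0 => φ h - 1 - h * G) =o[𝓝[>] 0] fun h : ℝ≥0 => (h : ℝ)) (t : ℝ≥0) :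
    φ t = Complex.exp (t * G) := by
  rcases eq_or_ne t 0 with rfl | ht
  · simp [h0]
  have hpow : ∀ (n : ℕ) (s : ℝ≥0), φ (n * s) = φ s ^ n := by
    intro n s
    induction n with
    | zero => simp [h0]
    | succ n ih => rw [Nat.cast_succ, add_mul, one_mul, hmul, ih, pow_succ]
  have hseq : Tendsto (fun n : ℕ => t / (n : ℝ≥0)) atTop (𝓝[>] 0) := by
    refine tendsto_nhdsWithin_iff.2 ⟨tendsto_const_div_atTop_nhds_zero_nat t, ?_⟩
    filter_upwards [eventually_gt_atTop 0] with n hn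
    have ht0 : 0 < t := pos_iff_ne_zero.2 ht
    have hn0 : (0 : ℝ≥0) < n := by exact_mod_cast hn
    exact div_pos ht0 hn0
  have h1 : Tendsto (fun h : ℝ≥0 => ((h : ℝ))⁻¹ • (φ h - 1 - h * G)) (𝓝[>] 0) (𝓝 0) :=
    hG.tendsto_inv_smul_nhds_zero
  have h2 := ((h1.comp hseq).const_mul (t : ℂ)).add_const ((t : ℂ) * G)
  simp only [mul_zero, zero_add, Function.comp_def] at h2
  have h3 : Tendsto (fun n : ℕ => (n : ℂ) * (φ (t / n) - 1)) atTop (𝓝 (t * G)) := by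
    refine h2.congr' ?_
    filter_upwards [eventually_gt_atTop 0] with n hn
    have hn' : (n : ℂ) ≠ 0 := by exact_mod_cast hn.ne'
    have ht' : (t : ℂ) ≠ 0 := by exact_mod_cast ht
    rw [Complex.real_smul]
    push_cast
    field_simp
    ring
  have h4 := Complex.tendsto_one_add_pow_exp_of_tendsto h3
  refine tendsto_nhds_unique (tendsto_const_nhds.congr' ?_) h4
  filter_upwards [eventually_gt_atTop 0] with n hn
  have hn' : (n : ℝ≥0) ≠ 0 := by exact_mod_cast hn.ne'
  rw [add_sub_cancel, ← hpow, mul_div_cancel₀ _ hn']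

section GCP

variable {Ω : Type*} [MeasurableSpace Ω] {P : Measure Ω} {k : ℕ} {lam : ℕ → ℝ} {M : ℝ≥0 → Ω → ℕ}

theorem IsGCP.measurable (hM : IsGCP k lam M P) (t : ℝ≥0) : Measurable (M t) := by
  refine measurable_to_countable' fun n => ?_
  have := hM.levy.measurable t (measurableSet_singleton (n : ℤ))
  convert this using 1
  ext ω
  simp

theorem IsGCP.ae_zero (hM : IsGCP k lam M P) : ∀ᵐ ω ∂P, M 0 ω = 0 := by
  filter_upwards [hM.levy.zero] with ω hω
  exact_mod_cast hω

theorem IsGCP.integral_pow_add (hM : IsGCP k lam M P) {u : ℂ} (s t : ℝ≥0) :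
    ∫ ω, u ^ M (s + t) ω ∂P = (∫ ω, u ^ M s ω ∂P) * ∫ ω, u ^ M t ω ∂P := by
  -- Increments live in ℤ, but have the law of some `M t` and are almost surely nonnegative, so
  -- `toNat` loses nothing; natural exponents keep u = 0 admissible.
  set f : ℤ → ℂ := fun n => u ^ n.toNat with hf
  have hfm : Measurable f := measurable_from_top
  have hst := hM.levy.stationary s t
  have hnonneg : ∀ᵐ ω ∂P, (0 : ℤ) ≤ M (s + t) ω - M s ω := by
    have := hst.symm.ae_snd (p := fun n : ℤ => 0 ≤ n) (measurableSet_Ici)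
      (ae_of_all _ fun ω => by positivity)
    exact this
  have hind : IndepFun (fun ω => (M s ω : ℤ)) (fun ω => (M (s + t) ω : ℤ) - M s ω) P :=
    hM.levy.indep.indepFun_eval_sub (r := 0) zero_le le_self_add hM.levy.zero
  have h1 : ∫ ω, u ^ M (s + t) ω ∂P
      = ∫ ω, f (M s ω) * f ((M (s + t) ω : ℤ) - M s ω) ∂P := by
    refine integral_congr_ae ?_
    filter_upwards [hnonneg] with ω hω
    simp only [hf, ← pow_add]
    congr 1
    omega
  have h2 : ∫ ω, f ((M (s + t) ω : ℤ) - M s ω) ∂P = ∫ ω, f (M t ω) ∂P :=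
    (hst.comp hfm).integral_eq
  have h3 := (hind.comp hfm hfm).integral_fun_mul_eq_mul_integral
    (hfm.comp (hM.levy.measurable s)).aestronglyMeasurable
    (hfm.comp_aemeasurable hst.aemeasurable_fst).aestronglyMeasurable
  simp only [Function.comp_def] at h3
  rw [h1, h3, h2]
  simp [hf]

theorem hasSum_integral_pow {X : Ω → ℕ} (hX : Measurable X) {u : ℂ}
    (h : Integrable (fun ω => u ^ X ω) P) :
    HasSum (fun n => (P.real (X ⁻¹' {n}) : ℂ) * u ^ n) (∫ ω, u ^ X ω ∂P) := by
  have h1 := hasSum_integral_iUnion (μ := P) (f := fun ω => u ^ X ω) (s := fun n => X ⁻¹' {n})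
    (fun n => hX (measurableSet_singleton n))
    (fun a b hab => Disjoint.preimage _ (by simpa using hab)) h.integrableOn
  have h2 : ⋃ n, X ⁻¹' {n} = Set.univ := by
    ext ω
    simp
  rw [h2, setIntegral_univ] at h1
  refine h1.congr_fun fun n => ?_
  rw [setIntegral_congr_fun (g := fun _ => u ^ n) (hX (measurableSet_singleton n)) fun ω hω => by
    rw [Set.mem_preimage, Set.mem_singleton_iff] at hω; simp [hω]]
  rw [setIntegral_const]
  simp

variable [IsProbabilityMeasure P]

theorem IsGCP.initial_ne_zero (hM : IsGCP k lam M P) : P (M 0 ⁻¹' {0}) ≠ 0 := by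
  have : P (M 0 ⁻¹' {0}) = 1 :=
    (prob_compl_eq_zero_iff (hM.measurable 0 (measurableSet_singleton 0))).1 hM.ae_zero
  simp [this]

/-- Conditioning on an almost sure event is void, so the transition rates at t = 0, m = 0 describe
the law of `M h` itself. -/
theorem IsGCP.cond_initial (hM : IsGCP k lam M P) : P[|M 0 ⁻¹' {0}] = P := by
  have : P (M 0 ⁻¹' {0}) = 1 :=
    (prob_compl_eq_zero_iff (hM.measurable 0 (measurableSet_singleton 0))).1 hM.ae_zero
  rw [ProbabilityTheory.cond, this,
    Measure.restrict_eq_self_of_ae_mem (s := M 0 ⁻¹' {0}) hM.ae_zero]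
  simp

theorem IsGCP.integrable_pow (hM : IsGCP k lam M P) {u : ℂ} (hu : ‖u‖ ≤ 1) (t : ℝ≥0) :
    Integrable (fun ω => u ^ M t ω) P := by
  have hm : Measurable fun n : ℕ => u ^ n := measurable_from_top
  refine Integrable.of_bound (hm.comp (hM.measurable t)).aestronglyMeasurable 1
    (ae_of_all _ fun ω => ?_)
  rw [norm_pow]
  exact pow_le_one₀ (norm_nonneg _) hu

/-- The small-time expansion of the generating function of a generalized counting process. -/
theorem IsGCP.isLittleO_integral_pow (hM : IsGCP k lam M P) {u : ℂ} (hu : ‖u‖ ≤ 1) :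
    (fun h : ℝ≥0 => ∫ ω, u ^ M h ω ∂P - 1 - h * ∑ j ∈ Finset.Icc 1 k, (lam j : ℂ) * (u ^ j - 1))
      =o[𝓝[>] 0] fun h : ℝ≥0 => (h : ℝ) := by
  have hstay := hM.stay 0 0 hM.initial_ne_zero
  have hjump := hM.jump 0 0 hM.initial_ne_zero
  simp only [hM.cond_initial, zero_add] at hstay hjump
  set p : ℕ → ℝ≥0 → ℝ := fun n h => P.real (M h ⁻¹' {n}) with hp
  set e0 : ℝ≥0 → ℝ := fun h => p 0 h - (1 - (∑ j ∈ Finset.Icc 1 k, lam j) * (h : ℝ)) with he0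
  set e : ℕ → ℝ≥0 → ℝ := fun j h => p j h - lam j * (h : ℝ) with he
  -- The factor 2 counts the errors once for the states 0, …, k and once for the mass beyond k,
  -- which is minus their sum.
  have hE : (fun h => 2 * (|e0 h| + ∑ j ∈ Finset.Icc 1 k, |e j h|))
      =o[𝓝[>] 0] fun h : ℝ≥0 => (h : ℝ) :=
    (hstay.abs_left.add (by
      simpa [Finset.sum_fn, he, hp] using
        IsLittleO.sum fun j hj => (hjump j hj).abs_left)).const_mul_left 2
  refine IsLittleO.trans_le (IsBigO.trans_isLittleO (IsBigO.of_bound 1 (Eventually.of_forall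
    fun h => ?_)) hE) fun _ => le_rfl
  set S : Finset ℕ := Finset.range (k + 1) with hS
  have hSsum : ∀ {E : Type} [AddCommMonoid E] (f : ℕ → E),
      ∑ n ∈ S, f n = f 0 + ∑ j ∈ Finset.Icc 1 k, f j := by
    intro E _ f
    rw [hS, Finset.range_eq_Ico, Finset.sum_eq_sum_Ico_succ_bot (by omega)]
    rfl
  have hmset : ∀ n, MeasurableSet (M h ⁻¹' {n}) := fun n =>
    hM.measurable h (measurableSet_singleton n)
  set T : Set Ω := M h ⁻¹' (S : Set ℕ) with hT
  have hTm : MeasurableSet T := hM.measurable h (Finset.measurableSet S)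
  have hTU : T = ⋃ n ∈ S, M h ⁻¹' {n} := by
    ext ω
    simp [hT]
  have hdisj : Set.PairwiseDisjoint (S : Set ℕ) fun n => M h ⁻¹' {n} := fun a _ b _ hab =>
    Disjoint.preimage _ (by simpa using hab)
  have hint := hM.integrable_pow hu h
  have h1 : ∫ ω in T, u ^ M h ω ∂P = ∑ n ∈ S, (p n h : ℂ) * u ^ n := by
    rw [hTU, integral_biUnion_finset S (fun n _ => hmset n) hdisj fun n _ => hint.integrableOn]
    refine Finset.sum_congr rfl fun n _ => ?_
    rw [setIntegral_congr_fun (g := fun _ => u ^ n) (hmset n) fun ω hω => by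
      rw [Set.mem_preimage, Set.mem_singleton_iff] at hω; simp [hω]]
    rw [setIntegral_const]
    simp [hp]
  have h2 : P.real T = ∑ n ∈ S, p n h := by
    rw [hTU, measureReal_biUnion_finset hdisj fun n _ => hmset n]
  have h3 : ‖∫ ω in Tᶜ, u ^ M h ω ∂P‖ ≤ 1 - ∑ n ∈ S, p n h := by
    refine (norm_setIntegral_le_of_norm_le_const (measure_lt_top _ _) fun ω _ => ?_).trans_eq
      (b := 1 * P.real Tᶜ) ?_
    · rw [norm_pow]
      exact pow_le_one₀ (norm_nonneg _) hu
    · rw [one_mul, probReal_compl_eq_one_sub hTm, h2]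
  -- The first-order terms of staying and jumping cancel, so the total mass beyond k is o(h).
  have h4 : 1 - ∑ n ∈ S, p n h = -(e0 h + ∑ j ∈ Finset.Icc 1 k, e j h) := by
    simp only [hSsum, he0, he, Finset.sum_sub_distrib, Finset.sum_mul]
    ring
  have h5 : ∫ ω, u ^ M h ω ∂P - 1 - h * ∑ j ∈ Finset.Icc 1 k, (lam j : ℂ) * (u ^ j - 1)
      = (e0 h : ℂ) + ∑ j ∈ Finset.Icc 1 k, (e j h : ℂ) * u ^ j + ∫ ω in Tᶜ, u ^ M h ω ∂P := by
    have h6 : ∑ j ∈ Finset.Icc 1 k, (e j h : ℂ) * u ^ j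
        = ∑ j ∈ Finset.Icc 1 k, (p j h : ℂ) * u ^ j
          - h * ∑ j ∈ Finset.Icc 1 k, (lam j : ℂ) * u ^ j := by
      rw [Finset.mul_sum, ← Finset.sum_sub_distrib]
      refine Finset.sum_congr rfl fun j _ => ?_
      simp only [he]
      push_cast
      ring
    have h7 : ∑ j ∈ Finset.Icc 1 k, (lam j : ℂ) * (u ^ j - 1)
        = ∑ j ∈ Finset.Icc 1 k, (lam j : ℂ) * u ^ j - ∑ j ∈ Finset.Icc 1 k, (lam j : ℂ) := by
      simp only [mul_sub, Finset.sum_sub_distrib, mul_one]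
    rw [← integral_add_compl hTm hint, h1, hSsum, h6, h7, he0]
    push_cast
    ring
  rw [h5, one_mul]
  have h6 : ‖∑ j ∈ Finset.Icc 1 k, (e j h : ℂ) * u ^ j‖ ≤ ∑ j ∈ Finset.Icc 1 k, |e j h| := by
    refine (norm_sum_le _ _).trans (Finset.sum_le_sum fun j _ => ?_)
    rw [norm_mul, norm_pow, Complex.norm_real, Real.norm_eq_abs]
    exact mul_le_of_le_one_right (abs_nonneg _) (pow_le_one₀ (norm_nonneg _) hu)
  have h7 : ‖(e0 h : ℂ)‖ = |e0 h| := by simp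
  have h8 : -(e0 h + ∑ j ∈ Finset.Icc 1 k, e j h) ≤ |e0 h| + ∑ j ∈ Finset.Icc 1 k, |e j h| := by
    refine (neg_le_abs _).trans ((abs_add_le _ _).trans ?_)
    gcongr
    exact Finset.abs_sum_le_sum_abs _ _
  have h9 := norm_add₃_le (a := (e0 h : ℂ)) (b := ∑ j ∈ Finset.Icc 1 k, (e j h : ℂ) * u ^ j)
    (c := ∫ ω in Tᶜ, u ^ M h ω ∂P)
  rw [Real.norm_of_nonneg (by positivity)]
  linarith

theorem IsGCP.integral_pow (hM : IsGCP k lam M P) {u : ℂ} (hu : ‖u‖ ≤ 1) (t : ℝ≥0) :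
    ∫ ω, u ^ M t ω ∂P
      = Complex.exp (t * ∑ j ∈ Finset.Icc 1 k, (lam j : ℂ) * (u ^ j - 1)) := by
  refine eq_exp_of_mul_of_isLittleO (φ := fun t => ∫ ω, u ^ M t ω ∂P) ?_
    (fun s t => hM.integral_pow_add s t) (hM.isLittleO_integral_pow hu) t
  have : ∫ ω, u ^ M 0 ω ∂P = ∫ _, 1 ∂P := integral_congr_ae (by
    filter_upwards [hM.ae_zero] with ω hω
    simp [hω])
  simpa using this

/-- On the unit disc the series represents F, hence it is the Taylor series of F at 0, which
converges everywhere for entire F. -/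
theorem hasSum_of_entire {F : ℂ → ℂ} (hF : Differentiable ℂ F) {p : ℕ → ℂ}
    (h : ∀ u : ℂ, ‖u‖ ≤ 1 → HasSum (fun n => p n * u ^ n) (F u)) (u : ℂ) :
    HasSum (fun n => p n * u ^ n) (F u) := by
  have h1 : HasFPowerSeriesAt F (FormalMultilinearSeries.ofScalars ℂ p) 0 := by
    rw [hasFPowerSeriesAt_iff]
    filter_upwards [Metric.closedBall_mem_nhds (0 : ℂ) one_pos] with z hz
    simpa [FormalMultilinearSeries.coeff_ofScalars, mul_comm] using
      h z (by simpa using hz)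
  have h2 := hF.hasFPowerSeriesOnBall 0 (R := 1) one_pos
  have h3 := h2.hasFPowerSeriesAt.eq_formalMultilinearSeries h1
  rw [h3] at h2
  have h4 := h2.hasSum (y := u) (by simp)
  simpa [FormalMultilinearSeries.ofScalars_apply_eq, mul_comm] using h4

theorem integrable_pow_of_summable {X : Ω → ℕ} (hX : Measurable X) {u : ℂ}
    (h : Summable fun n => ‖(P.real (X ⁻¹' {n}) : ℂ) * u ^ n‖) :
    Integrable (fun ω => u ^ X ω) P := by
  have hm : Measurable fun n : ℕ => u ^ n := measurable_from_top
  refine ⟨(hm.comp hX).aestronglyMeasurable, ?_⟩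
  rw [hasFiniteIntegral_iff_enorm, ← lintegral_map (f := fun n => ‖u ^ n‖ₑ) hm.enorm hX,
    lintegral_countable']
  have : ∀ n, ‖u ^ n‖ₑ * P.map X {n} = ‖(P.real (X ⁻¹' {n}) : ℂ) * u ^ n‖ₑ := fun n => by
    rw [Measure.map_apply hX (measurableSet_singleton n), enorm_mul, mul_comm]
    congr 1
    rw [← ofReal_norm, Complex.norm_real, Real.norm_of_nonneg measureReal_nonneg,
      ofReal_measureReal]
  simp only [this]
  have h2 := h.tsum_ofReal_lt_top
  simpa only [ofReal_norm] using h2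

/-- The generating function of a generalized counting process, at an arbitrary complex number. -/
theorem IsGCP.generatingFunction (hM : IsGCP k lam M P) (u : ℂ) (t : ℝ≥0) :
    Integrable (fun ω => u ^ M t ω) P ∧ ∫ ω, u ^ M t ω ∂P
      = Complex.exp (t * ∑ j ∈ Finset.Icc 1 k, (lam j : ℂ) * (u ^ j - 1)) := by
  set F : ℂ → ℂ := fun u => Complex.exp (t * ∑ j ∈ Finset.Icc 1 k, (lam j : ℂ) * (u ^ j - 1))
    with hF
  have hFd : Differentiable ℂ F := by
    rw [hF]
    fun_prop
  have hsum := hasSum_of_entire hFd (p := fun n => (P.real (M t ⁻¹' {n}) : ℂ)) fun v hv => by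
    simp only [hF, ← hM.integral_pow hv]
    exact hasSum_integral_pow (hM.measurable t) (hM.integrable_pow hv t)
  have hint := integrable_pow_of_summable (hM.measurable t) (hsum u).summable.norm
  exact ⟨hint, (hasSum_integral_pow (hM.measurable t) hint).unique (hsum u)⟩

/-- The generating function of the generalized Skellam process. -/
theorem skellam_generatingFunction {mu : ℕ → ℝ} {N : ℝ≥0 → Ω → ℕ} (hM : IsGCP k lam M P)
    (hN : IsGCP k mu N P) (hMN : IndepFun (fun ω t => M t ω) (fun ω t => N t ω) P) {u : ℂ}
    (hu : u ≠ 0) (t : ℝ≥0) :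
    Integrable (fun ω => u ^ skellam M N t ω) P ∧
      ∫ ω, u ^ skellam M N t ω ∂P = Complex.exp (symbol k lam mu u * t) := by
  obtain ⟨h1, h1'⟩ := hM.generatingFunction u t
  obtain ⟨h2, h2'⟩ := hN.generatingFunction u⁻¹ t
  have hm : ∀ v : ℂ, Measurable fun n : ℕ => v ^ n := fun v => measurable_from_top
  have hind : IndepFun (fun ω => u ^ M t ω) (fun ω => u⁻¹ ^ N t ω) P :=
    hMN.comp ((hm u).comp (measurable_pi_apply t)) ((hm u⁻¹).comp (measurable_pi_apply t))
  have heq : ∀ ω, u ^ skellam M N t ω = u ^ M t ω * u⁻¹ ^ N t ω := fun ω => by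
    rw [skellam, zpow_sub₀ hu, zpow_natCast, zpow_natCast, inv_pow, div_eq_mul_inv]
  simp only [heq]
  refine ⟨hind.integrable_mul h1 h2, ?_⟩
  rw [hind.integral_fun_mul_eq_mul_integral h1.1 h2.1, h1', h2', ← Complex.exp_add, ← mul_add,
    symbol, Finset.sum_add_distrib, mul_comm]
  simp

end GCP

/-! ### Laplace transforms determine laws -/

section Laplace

variable {Ω : Type*} [MeasurableSpace Ω] {P : Measure Ω} [IsProbabilityMeasure P]

theorem hasSum_mgf_of_bounded {U : Ω → ℝ} (hU : AEMeasurable U P) (hb : ∀ᵐ ω ∂P, |U ω| ≤ 1)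
    (r : ℝ) : HasSum (fun n : ℕ => r ^ n / n.factorial * ∫ ω, U ω ^ n ∂P) (mgf U P r) := by
  have hbn : ∀ n : ℕ, ∀ᵐ ω ∂P, ‖U ω ^ n‖ ≤ 1 := fun n => by
    filter_upwards [hb] with ω hω
    rw [norm_pow]
    exact pow_le_one₀ (norm_nonneg _) hω
  have hi : ∀ n : ℕ, Integrable (fun ω => U ω ^ n) P := fun n =>
    Integrable.of_bound (hU.pow_const n).aestronglyMeasurable 1 (hbn n)
  have h := hasSum_integral_of_summable_integral_norm (μ := P)
    (F := fun (n : ℕ) ω => r ^ n / n.factorial * U ω ^ n) (fun n => (hi n).const_mul _) ?_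
  · have h2 : ∫ ω, ∑' n : ℕ, r ^ n / n.factorial * U ω ^ n ∂P = mgf U P r := by
      refine integral_congr_ae (ae_of_all _ fun ω => ?_)
      simp only [Real.exp_eq_exp_ℝ, NormedSpace.exp_eq_tsum_div]
      refine tsum_congr fun n => ?_
      rw [mul_pow]
      ring
    rw [h2] at h
    simpa only [integral_const_mul] using h
  · refine (Real.summable_pow_div_factorial |r|).of_nonneg_of_le
      (fun n => integral_nonneg fun ω => norm_nonneg _) fun n => ?_
    calc ∫ ω, ‖r ^ n / n.factorial * U ω ^ n‖ ∂P ≤ ∫ ω, |r| ^ n / n.factorial ∂P := by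
          refine integral_mono_ae ((hi n).const_mul _).norm (integrable_const _) ?_
          filter_upwards [hbn n] with ω hω
          rw [norm_mul, norm_div, norm_pow, Real.norm_eq_abs, RCLike.norm_natCast]
          exact mul_le_of_le_one_right (by positivity) hω
      _ = |r| ^ n / n.factorial := by simp

/-- For bounded variables the moments sum to the moment generating function, finite on all of ℝ; its
analytic continuation determines the law. -/
theorem map_eq_of_moments_eq {U V : Ω → ℝ} (hU : AEMeasurable U P) (hV : AEMeasurable V P)
    (hUb : ∀ᵐ ω ∂P, |U ω| ≤ 1) (hVb : ∀ᵐ ω ∂P, |V ω| ≤ 1)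
    (h : ∀ n : ℕ, ∫ ω, U ω ^ n ∂P = ∫ ω, V ω ^ n ∂P) : P.map U = P.map V := by
  have hmgf : mgf U P = mgf V P := by
    ext r
    have h2 := hasSum_mgf_of_bounded hV hVb r
    simp only [← h] at h2
    exact (hasSum_mgf_of_bounded hU hUb r).unique h2
  have huniv : integrableExpSet U P = Set.univ := by
    refine Set.eq_univ_of_forall fun r => ?_
    refine Integrable.of_bound (by fun_prop) (Real.exp |r|) ?_
    filter_upwards [hUb] with ω hω
    rw [Real.norm_of_nonneg (Real.exp_pos _).le]
    gcongr
    calc r * U ω ≤ |r * U ω| := le_abs_self _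
      _ = |r| * |U ω| := abs_mul _ _
      _ ≤ |r| := mul_le_of_le_one_right (abs_nonneg _) hω
  refine Measure.ext_of_complexMGF_eq hU hV (funext fun z => ?_)
  exact eqOn_complexMGF_of_mgf hmgf (by simp [huniv])

/-- The Laplace transform determines the law of a nonnegative random variable. -/
theorem map_eq_of_laplace_eq {A B : Ω → ℝ} (hA : AEMeasurable A P) (hB : AEMeasurable B P)
    (hA0 : ∀ᵐ ω ∂P, 0 ≤ A ω) (hB0 : ∀ᵐ ω ∂P, 0 ≤ B ω)
    (h : ∀ s : ℝ, 0 < s → ∫ ω, Real.exp (-s * A ω) ∂P = ∫ ω, Real.exp (-s * B ω) ∂P) :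
    P.map A = P.map B := by
  have hb : ∀ {X : Ω → ℝ}, (∀ᵐ ω ∂P, 0 ≤ X ω) → ∀ᵐ ω ∂P, |Real.exp (-X ω)| ≤ 1 := by
    intro X hX
    filter_upwards [hX] with ω hω
    rw [abs_of_pos (Real.exp_pos _), Real.exp_le_one_iff]
    linarith
  -- Since X = -log exp(-X), it suffices to identify the law of exp(-X), which is bounded and whose
  -- n-th moment is the Laplace transform at n.
  have hlog : ∀ {X : Ω → ℝ}, AEMeasurable X P →
      P.map X = (P.map fun ω => Real.exp (-X ω)).map fun y => -Real.log y := by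
    intro X hX
    rw [AEMeasurable.map_map_of_aemeasurable (by fun_prop) (by fun_prop)]
    congr 1
    ext ω
    simp
  rw [hlog hA, hlog hB, map_eq_of_moments_eq (U := fun ω => Real.exp (-A ω))
    (V := fun ω => Real.exp (-B ω)) (by fun_prop) (by fun_prop) (hb hA0) (hb hB0) fun n => ?_]
  rcases Nat.eq_zero_or_pos n with rfl | hn
  · simp
  · simpa [← Real.exp_nat_mul] using h n (by exact_mod_cast hn)

end Laplace

/-! ### Stable subordinators: tails, scaling, negative moments -/

section Subordinator

variable {Ω : Type*} [MeasurableSpace Ω] {P : Measure Ω} {α : ℝ} {A : ℝ≥0 → Ω → ℝ}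

theorem IsSubordinator.nonneg (hA : IsSubordinator A P) : ∀ᵐ ω ∂P, ∀ t, 0 ≤ A t ω := by
  filter_upwards [hA.mono, hA.levy.zero] with ω h1 h2 t
  exact h2.ge.trans (h1 zero_le)

variable [IsProbabilityMeasure P]

/-- Chernoff's bound for the lower tail. -/
theorem IsSubordinator.measure_le_le (hA : IsSubordinator A P) (t : ℝ≥0) (c : ℝ) {s : ℝ}
    (hs : 0 ≤ s) :
    P.real {ω | A t ω ≤ c} ≤ Real.exp (s * c) * ∫ ω, Real.exp (-s * A t ω) ∂P := by
  have hm := hA.levy.measurable t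
  have hint : Integrable (fun ω => Real.exp (-s * A t ω)) P := by
    refine Integrable.of_bound (by fun_prop) 1 ?_
    filter_upwards [hA.nonneg] with ω hω
    rw [Real.norm_of_nonneg (Real.exp_pos _).le, Real.exp_le_one_iff]
    nlinarith [hω t]
  rw [← integral_const_mul, ← integral_indicator_one (measurableSet_le hm measurable_const)]
  refine integral_mono ((integrable_const 1).indicator (measurableSet_le hm measurable_const))
    (hint.const_mul _) fun ω => ?_
  simp only [Set.indicator_apply, ← Real.exp_add]
  split_ifs with h
  · have : A t ω ≤ c := h
    rw [Pi.one_apply, Real.one_le_exp_iff]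
    nlinarith
  · positivity

/-- P(A_n ≤ c) ≤ e^{c-n} → 0. Consequently `firstPassage` is almost surely an infimum of nonempty
sets and never the default value `sInf ∅ = 0`. -/
theorem IsStableSubordinator.unbounded (hA : IsStableSubordinator α A P) :
    ∀ᵐ ω ∂P, ∀ s : ℝ≥0, ∃ x, (s : ℝ) < A x ω := by
  have key : ∀ c : ℕ, ∀ᵐ ω ∂P, ∃ x : ℝ≥0, (c : ℝ) < A x ω := by
    intro c
    have hz : P.real {ω | ∀ x : ℝ≥0, A x ω ≤ c} = 0 := by
      refine le_antisymm ?_ measureReal_nonneg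
      have hlim : Tendsto (fun n : ℕ => Real.exp (1 * c) * Real.exp (-(n : ℝ))) atTop (𝓝 0) := by
        simpa using (Real.tendsto_exp_neg_atTop_nhds_zero.comp
          tendsto_natCast_atTop_atTop).const_mul (Real.exp (1 * c))
      refine ge_of_tendsto' hlim fun n => ?_
      have h1 := hA.subordinator.measure_le_le (n : ℝ≥0) c zero_le_one
      rw [hA.laplace _ 1 one_pos] at h1
      simp only [Real.one_rpow, mul_one, NNReal.coe_natCast] at h1
      exact (measureReal_mono fun ω (hω : ∀ x : ℝ≥0, A x ω ≤ c) => hω n).trans h1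
    rw [measureReal_eq_zero_iff] at hz
    rw [ae_iff]
    simpa only [not_exists, not_lt] using hz
  filter_upwards [ae_all_iff.2 key] with ω hω s
  obtain ⟨x, hx⟩ := hω ⌈s⌉₊
  exact ⟨x, lt_of_le_of_lt (by exact_mod_cast Nat.le_ceil s) hx⟩

theorem IsStableSubordinator.apply_one_pos (hα : 0 < α) (hA : IsStableSubordinator α A P) :
    ∀ᵐ ω ∂P, 0 < A 1 ω := by
  have hz : P.real {ω | A 1 ω ≤ 0} = 0 := by
    refine le_antisymm ?_ measureReal_nonneg
    have hlim : Tendsto (fun s : ℝ => Real.exp (-s ^ α)) atTop (𝓝 0) :=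
      Real.tendsto_exp_neg_atTop_nhds_zero.comp (tendsto_rpow_atTop hα)
    refine ge_of_tendsto hlim ?_
    filter_upwards [eventually_gt_atTop 0] with s hs
    have h1 := hA.subordinator.measure_le_le 1 0 hs.le
    rw [hA.laplace _ s hs] at h1
    simpa using h1
  rw [measureReal_eq_zero_iff] at hz
  rw [ae_iff]
  simpa only [not_lt] using hz

theorem IsStableSubordinator.map_eq_scaled (hα : 0 < α) (hA : IsStableSubordinator α A P)
    {x : ℝ≥0} (hx : 0 < x) :
    P.map (A x) = P.map fun ω => (x : ℝ) ^ α⁻¹ * A 1 ω := by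
  have hm := hA.subordinator.levy.measurable
  have hx' : (0 : ℝ) < x := hx
  refine map_eq_of_laplace_eq (hm x).aemeasurable ((hm 1).const_mul _).aemeasurable
    (hA.subordinator.nonneg.mono fun ω h => h x)
    (hA.subordinator.nonneg.mono fun ω h => mul_nonneg (by positivity) (h 1)) fun s hs => ?_
  have h1 := hA.laplace 1 (s * (x : ℝ) ^ α⁻¹) (by positivity)
  rw [hA.laplace x s hs]
  simp only [neg_mul, mul_assoc] at h1 ⊢
  rw [h1, Real.mul_rpow hs.le (by positivity), ← Real.rpow_mul hx'.le, inv_mul_cancel₀ hα.ne']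
  simp [mul_comm]

theorem lintegral_rpow_mul_exp_neg_mul {q a : ℝ} (hq : 0 < q) (ha : 0 < a) :
    ∫⁻ p in Set.Ioi (0 : ℝ), ENNReal.ofReal (p ^ (q - 1)) * ENNReal.ofReal (Real.exp (-p * a))
      = ENNReal.ofReal (Real.Gamma q) * ENNReal.ofReal (a ^ (-q)) := by
  have hI : IntegrableOn (fun p : ℝ => p ^ (q - 1) * Real.exp (-p * a)) (Set.Ioi 0) := by
    have := integrableOn_rpow_mul_exp_neg_mul_rpow (p := 1) (s := q - 1) (b := a) (by linarith)
      zero_lt_one ha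
    refine this.congr_fun (fun p _ => ?_) measurableSet_Ioi
    simp [mul_comm]
  have h := Real.integral_rpow_mul_exp_neg_mul_Ioi hq ha
  rw [← ENNReal.ofReal_mul (Real.Gamma_pos_of_pos hq).le]
  have h2 : Real.Gamma q * a ^ (-q) = ∫ p in Set.Ioi (0 : ℝ), p ^ (q - 1) * Real.exp (-p * a) := by
    rw [Real.rpow_neg ha.le, ← Real.inv_rpow ha.le, ← one_div, mul_comm, ← h]
    simp [mul_comm]
  rw [h2, ofReal_integral_eq_lintegral_ofReal hI]
  · refine setLIntegral_congr_fun measurableSet_Ioi fun p hp => ?_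
    have : (0 : ℝ) < p := hp
    rw [ENNReal.ofReal_mul (by positivity)]
  · filter_upwards [ae_restrict_mem measurableSet_Ioi] with p hp
    have : (0 : ℝ) < p := hp
    positivity

/-- Negative moments of a stable subordinator at time `1`. -/
theorem IsStableSubordinator.lintegral_rpow_neg (hα : 0 < α) (hA : IsStableSubordinator α A P)
    {q : ℝ} (hq : 0 < q) :
    ENNReal.ofReal (Real.Gamma q) * ∫⁻ ω, ENNReal.ofReal (A 1 ω ^ (-q)) ∂P
      = ENNReal.ofReal (1 / α * Real.Gamma (q / α)) := by
  have hm := hA.subordinator.levy.measurable 1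
  -- Γ(q) a^{-q} is the integral of p^{q-1} e^{-pa}; after Tonelli the inner expectation is the
  -- Laplace transform e^{-p^α}.
  have h1 : ∫⁻ ω, ENNReal.ofReal (Real.Gamma q) * ENNReal.ofReal (A 1 ω ^ (-q)) ∂P
      = ∫⁻ ω, (∫⁻ p in Set.Ioi (0 : ℝ),
        ENNReal.ofReal (p ^ (q - 1)) * ENNReal.ofReal (Real.exp (-p * A 1 ω))) ∂P := by
    refine lintegral_congr_ae ?_
    filter_upwards [hA.apply_one_pos hα] with ω hω
    rw [lintegral_rpow_mul_exp_neg_mul hq hω]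
  rw [← lintegral_const_mul _ (by fun_prop), h1, lintegral_lintegral_swap (by fun_prop)]
  have h2 : ∀ p ∈ Set.Ioi (0 : ℝ), ∫⁻ ω, ENNReal.ofReal (p ^ (q - 1)) *
      ENNReal.ofReal (Real.exp (-p * A 1 ω)) ∂P
      = ENNReal.ofReal (p ^ (q - 1) * Real.exp (-p ^ α)) := by
    intro p hp
    have hp' : (0 : ℝ) < p := hp
    have hl := hA.laplace 1 p hp
    rw [lintegral_const_mul _ (by fun_prop), ← ofReal_integral_eq_lintegral_ofReal _
      (ae_of_all _ fun ω => (Real.exp_pos _).le), hl, ENNReal.ofReal_mul (by positivity)]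
    · simp
    · refine Integrable.of_bound (by fun_prop) 1 ?_
      filter_upwards [hA.subordinator.nonneg] with ω hω
      rw [Real.norm_of_nonneg (Real.exp_pos _).le, Real.exp_le_one_iff]
      nlinarith [hω 1]
  rw [setLIntegral_congr_fun measurableSet_Ioi h2, ← ofReal_integral_eq_lintegral_ofReal,
    integral_rpow_mul_exp_neg_rpow hα (by linarith)]
  · congr 3
    ring
  -- A non-integrable function would have Bochner integral 0, whereas the computed value is
  -- positive.
  · by_contra hni
    have h3 := integral_undef hni
    rw [integral_rpow_mul_exp_neg_rpow hα (by linarith)] at h3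
    have : 0 < Real.Gamma ((q - 1 + 1) / α) :=
      Real.Gamma_pos_of_pos (div_pos (by linarith) hα)
    have : 0 < 1 / α * Real.Gamma ((q - 1 + 1) / α) := by positivity
    linarith
  · filter_upwards [ae_restrict_mem measurableSet_Ioi] with p hp
    have : (0 : ℝ) < p := hp
    positivity

end Subordinator

/-! ### First passage times of stable subordinators -/

section FirstPassage

theorem firstPassage_le {Ω : Type*} {A : ℝ≥0 → Ω → ℝ} {ω : Ω} {s x : ℝ≥0}
    (h : (s : ℝ) < A x ω) : firstPassage A s ω ≤ x :=
  csInf_le (OrderBot.bddBelow _) h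

theorem firstPassage_mono {Ω : Type*} {A : ℝ≥0 → Ω → ℝ} {ω : Ω}
    (hu : ∀ s : ℝ≥0, ∃ x, (s : ℝ) < A x ω) : Monotone fun s => firstPassage A s ω := by
  intro s s' hs
  refine csInf_le_csInf (OrderBot.bddBelow _) (hu s') fun x hx => ?_
  exact lt_of_le_of_lt (NNReal.coe_le_coe.2 hs) hx

/-- The strict inequality s < A(x) survives a small increase of s, so the passage time cannot jump
up just to the right of s. -/
theorem firstPassage_rightCts {Ω : Type*} {A : ℝ≥0 → Ω → ℝ} {ω : Ω}
    (hu : ∀ s : ℝ≥0, ∃ x, (s : ℝ) < A x ω) (s : ℝ≥0) :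
    ContinuousWithinAt (fun s => firstPassage A s ω) (Set.Ici s) s := by
  refine tendsto_order.2 ⟨fun a ha => ?_, fun b hb => ?_⟩
  · filter_upwards [self_mem_nhdsWithin] with s' hs'
    exact ha.trans_le (firstPassage_mono hu hs')
  · obtain ⟨x, hx, hxb⟩ := exists_lt_of_csInf_lt (hu s) hb
    have h1 : ∀ᶠ s' : ℝ≥0 in 𝓝 s, (s' : ℝ) < A x ω :=
      NNReal.continuous_coe.continuousAt.eventually (gt_mem_nhds hx)
    filter_upwards [mem_nhdsWithin_of_mem_nhds h1] with s' hs'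
    exact (firstPassage_le hs').trans_lt hxb

variable {Ω : Type*} [MeasurableSpace Ω] {P : Measure Ω} {α : ℝ} {A : ℝ≥0 → Ω → ℝ}

/-- Along monotone paths the infimum may be taken over nonnegative rationals; the value `⊤` removes
those not yet past the level. -/
theorem aemeasurable_firstPassage (hA : ∀ t, Measurable (A t))
    (hm : ∀ᵐ ω ∂P, Monotone fun t => A t ω) (hu : ∀ᵐ ω ∂P, ∀ s : ℝ≥0, ∃ x, (s : ℝ) < A x ω)
    (s : ℝ≥0) : AEMeasurable (firstPassage A s) P := by
  classical
  set G : Ω → ℝ≥0∞ := fun ω => ⨅ p : ℕ × ℕ,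
    if (s : ℝ) < A (p.1 / (p.2 + 1)) ω then (((p.1 / (p.2 + 1) : ℝ≥0)) : ℝ≥0∞) else ⊤ with hG
  have hGm : Measurable G := Measurable.iInf fun p =>
    Measurable.ite (measurableSet_lt measurable_const (hA _)) measurable_const measurable_const
  refine ⟨fun ω => (G ω).toNNReal, hGm.ennreal_toNNReal, ?_⟩
  filter_upwards [hm, hu] with ω h1 h2
  suffices h : G ω = firstPassage A s ω by rw [h, ENNReal.toNNReal_coe]
  refine le_antisymm (le_of_forall_gt fun b hb => ?_) (le_iInf fun p => ?_)
  · have hlt : ∃ x : ℝ≥0, (s : ℝ) < A x ω ∧ (x : ℝ≥0∞) < b := by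
      rcases eq_or_ne b ⊤ with rfl | hbt
      · exact (h2 s).imp fun x hx => ⟨hx, ENNReal.coe_lt_top⟩
      · lift b to ℝ≥0 using hbt
        obtain ⟨x, hx, hxb⟩ := exists_lt_of_csInf_lt (h2 s) (ENNReal.coe_lt_coe.1 hb)
        exact ⟨x, hx, ENNReal.coe_lt_coe.2 hxb⟩
    obtain ⟨x, hx, hxb⟩ := hlt
    have hev : ∀ᶠ n in atTop, ((gridAbove n x : ℝ≥0) : ℝ≥0∞) < b :=
      ((ENNReal.continuous_coe.tendsto x).comp
        (tendsto_nhds_of_tendsto_nhdsWithin (tendsto_gridAbove x))).eventually (gt_mem_nhds hxb)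
    obtain ⟨n, hn⟩ := hev.exists
    refine lt_of_le_of_lt (iInf_le _ (⌊x * (n + 1)⌋₊ + 1, n)) ?_
    have hlt : (s : ℝ) < A (gridAbove n x) ω := hx.trans_le (h1 (lt_gridAbove n x).le)
    rw [gridAbove] at hn hlt
    rwa [if_pos hlt]
  · split_ifs with h
    · exact ENNReal.coe_le_coe.2 (firstPassage_le h)
    · exact le_top

theorem integrable_exp_mul_of_moments {Y : Ω → ℝ≥0} (hY : AEMeasurable Y P) {c : ℕ → ℝ}
    (hc : ∀ n, 0 ≤ c n) (hsum : ∀ x : ℝ, 0 ≤ x → Summable fun n => x ^ n * c n)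
    (h : ∀ n : ℕ, ∫⁻ ω, ENNReal.ofReal ((Y ω : ℝ) ^ n) ∂P = ENNReal.ofReal (n.factorial * c n))
    (z : ℂ) :
    Integrable (fun ω => Complex.exp (z * Y ω)) P ∧
      ∫ ω, Complex.exp (z * Y ω) ∂P = ∑' n, z ^ n * (c n : ℂ) := by
  have hfact : ∀ n : ℕ, (0 : ℝ) ≤ n.factorial * c n := fun n => mul_nonneg (by positivity) (hc n)
  have hint : ∀ n : ℕ, Integrable (fun ω => (Y ω : ℝ) ^ n) P := by
    intro n
    refine ⟨(hY.coe_nnreal_real.pow_const n).aestronglyMeasurable, ?_⟩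
    rw [hasFiniteIntegral_iff_ofReal (ae_of_all _ fun ω => by positivity), h]
    exact ENNReal.ofReal_lt_top
  have hval : ∀ n : ℕ, ∫ ω, (Y ω : ℝ) ^ n ∂P = n.factorial * c n := by
    intro n
    rw [integral_eq_lintegral_of_nonneg_ae (ae_of_all _ fun ω => by positivity) (hint n).1, h,
      ENNReal.toReal_ofReal (hfact n)]
  have hF : ∀ n : ℕ, Integrable (fun ω => z ^ n / n.factorial * ((Y ω : ℝ) ^ n : ℝ)) P :=
    fun n => (hint n).ofReal.const_mul _
  have hnorm : ∀ n : ℕ, ∫ ω, ‖z ^ n / n.factorial * (((Y ω : ℝ) ^ n : ℝ) : ℂ)‖ ∂P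
      = ‖z‖ ^ n * c n := by
    intro n
    simp only [norm_mul, norm_div, norm_pow, RCLike.norm_natCast, Complex.norm_real, Real.norm_eq_abs,
      NNReal.abs_eq]
    rw [integral_const_mul, hval]
    field_simp
  have hexp : ∀ ω, HasSum (fun n : ℕ => z ^ n / n.factorial * (((Y ω : ℝ) ^ n : ℝ) : ℂ))
      (Complex.exp (z * Y ω)) := by
    intro ω
    rw [Complex.exp_eq_exp_ℂ]
    refine (NormedSpace.expSeries_div_hasSum_exp (z * (Y ω : ℂ))).congr_fun fun n => ?_
    rw [mul_pow]
    push_cast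
    ring
  have hS : Summable fun n : ℕ => ∫ ω, ‖z ^ n / n.factorial * (((Y ω : ℝ) ^ n : ℝ) : ℂ)‖ ∂P := by
    simpa only [hnorm] using hsum ‖z‖ (norm_nonneg z)
  have hres := hasSum_integral_of_summable_integral_norm hF hS
  simp only [(hexp _).tsum_eq] at hres
  refine ⟨⟨by fun_prop, ?_⟩, ?_⟩
  · calc ∫⁻ ω, ‖Complex.exp (z * Y ω)‖ₑ ∂P
        ≤ ∫⁻ ω, ∑' n : ℕ, ‖z ^ n / n.factorial * (((Y ω : ℝ) ^ n : ℝ) : ℂ)‖ₑ ∂P := by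
          refine lintegral_mono fun ω => ?_
          rw [← (hexp ω).tsum_eq]
          exact enorm_tsum_le_tsum_enorm
      _ = ∑' n : ℕ, ∫⁻ ω, ‖z ^ n / n.factorial * (((Y ω : ℝ) ^ n : ℝ) : ℂ)‖ₑ ∂P :=
          lintegral_tsum fun n => (hF n).1.enorm
      _ = ∑' n : ℕ, ENNReal.ofReal (‖z‖ ^ n * c n) := by
          refine tsum_congr fun n => ?_
          rw [← hnorm n, ofReal_integral_norm_eq_lintegral_enorm (hF n)]
      _ < ⊤ := (hsum ‖z‖ (norm_nonneg z)).tsum_ofReal_lt_top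
  · rw [← hres.tsum_eq]
    refine tsum_congr fun n => ?_
    rw [integral_const_mul, integral_complex_ofReal, hval]
    have : (n.factorial : ℂ) ≠ 0 := by exact_mod_cast n.factorial_ne_zero
    push_cast
    field_simp

variable [IsProbabilityMeasure P]

/-- By self-similarity P(A_x ≤ s) = P(x ≤ W) with W = (s/A_1)^α, so the passage time has the moments
of W, which are negative moments of A_1. -/
theorem IsStableSubordinator.lintegral_firstPassage_pow (hα : 0 < α)
    (hA : IsStableSubordinator α A P) (s : ℝ≥0) (n : ℕ) :
    ∫⁻ ω, ENNReal.ofReal ((firstPassage A s ω : ℝ) ^ n) ∂P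
      = ENNReal.ofReal (n.factorial * fracCoeff α s n) := by
  rcases Nat.eq_zero_or_pos n with rfl | hn
  · simp [fracCoeff]
  have hm := hA.subordinator.levy.measurable
  have hYm := aemeasurable_firstPassage hm hA.subordinator.mono hA.unbounded s
  have hn' : (0 : ℝ) < n := by exact_mod_cast hn
  set W : Ω → ℝ := fun ω => ((s : ℝ) / A 1 ω) ^ α with hW
  have hWm : Measurable W := (measurable_const.div (hm 1)).pow_const α
  have hA1 := hA.apply_one_pos hα
  have hW0 : ∀ᵐ ω ∂P, 0 ≤ W ω := by
    filter_upwards [hA1] with ω hω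
    positivity
  have hscale : ∀ x : ℝ, 0 < x → P {ω | A x.toNNReal ω ≤ s} = P {ω | x ≤ W ω} := by
    intro x hx
    have h1 : P {ω | A x.toNNReal ω ≤ s} = P {ω | x ^ α⁻¹ * A 1 ω ≤ s} := by
      have h2 := hA.map_eq_scaled hα (x := x.toNNReal) (Real.toNNReal_pos.2 hx)
      rw [Real.coe_toNNReal x hx.le] at h2
      have h3 := DFunLike.congr_fun h2 (Set.Iic (s : ℝ))
      rwa [Measure.map_apply (hm _) measurableSet_Iic,
        Measure.map_apply ((hm 1).const_mul _) measurableSet_Iic] at h3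
    rw [h1]
    refine measure_congr ?_
    filter_upwards [hA1] with ω hω
    refine propext ?_
    change x ^ α⁻¹ * A 1 ω ≤ s ↔ x ≤ W ω
    rw [← le_div_iff₀ hω, Real.rpow_inv_le_iff_of_pos hx.le (by positivity) hα]
  have hmoment : ∫⁻ ω, ENNReal.ofReal ((firstPassage A s ω : ℝ) ^ (n : ℝ)) ∂P
      = ∫⁻ ω, ENNReal.ofReal (W ω ^ (n : ℝ)) ∂P := by
    -- Layer-cake formulas with {Y > x} ⊆ {A_x ≤ s} for one bound and, almost surely, {A_x ≤ s} ⊆ {Y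
    -- ≥ x} for the other; strict and weak tails give the same moment.
    refine le_antisymm ?_ ?_
    · rw [lintegral_rpow_eq_lintegral_meas_lt_mul P (ae_of_all _ fun ω => NNReal.coe_nonneg _)
        hYm.coe_nnreal_real hn', lintegral_rpow_eq_lintegral_meas_le_mul P hW0 hWm.aemeasurable hn']
      gcongr ENNReal.ofReal _ * ?_
      refine setLIntegral_mono' measurableSet_Ioi fun x hx => ?_
      rw [← hscale x hx]
      gcongr ?_ * _
      refine measure_mono fun ω (hω : x < firstPassage A s ω) => ?_
      by_contra hlt
      have h1 : firstPassage A s ω ≤ x.toNNReal :=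
        firstPassage_le (not_le.1 hlt)
      exact absurd ((Real.le_toNNReal_iff_coe_le (le_of_lt hx)).1 h1) (not_le.2 hω)
    · rw [lintegral_rpow_eq_lintegral_meas_le_mul P (ae_of_all _ fun ω => NNReal.coe_nonneg _)
        hYm.coe_nnreal_real hn', lintegral_rpow_eq_lintegral_meas_le_mul P hW0 hWm.aemeasurable hn']
      gcongr ENNReal.ofReal _ * ?_
      refine setLIntegral_mono' measurableSet_Ioi fun x hx => ?_
      rw [← hscale x hx]
      gcongr ?_ * _
      refine measure_mono_ae ?_
      filter_upwards [hA.subordinator.mono, hA.unbounded] with ω h1 h2 hω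
      change x ≤ firstPassage A s ω
      rw [← Real.toNNReal_le_iff_le_coe]
      refine le_csInf (h2 s) fun y hy => ?_
      by_contra hlt
      have h3 : A y ω ≤ A x.toNNReal ω := h1 (not_le.1 hlt).le
      exact absurd (lt_of_lt_of_le hy h3) (not_lt.2 hω)
  simp only [Real.rpow_natCast] at hmoment
  rw [hmoment]
  have hq : 0 < (n : ℝ) * α := by positivity
  have hneg := hA.lintegral_rpow_neg hα hq
  have hΓ : 0 < Real.Gamma (n * α) := Real.Gamma_pos_of_pos hq
  have h1 : ∫⁻ ω, ENNReal.ofReal (W ω ^ n) ∂P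
      = ENNReal.ofReal ((s : ℝ) ^ ((n : ℝ) * α))
        * ∫⁻ ω, ENNReal.ofReal (A 1 ω ^ (-((n : ℝ) * α))) ∂P := by
    have := hm 1
    rw [← lintegral_const_mul _ (by fun_prop)]
    refine lintegral_congr_ae ?_
    filter_upwards [hA1] with ω hω
    rw [← ENNReal.ofReal_mul (by positivity), hW]
    congr 1
    rw [← Real.rpow_natCast, ← Real.rpow_mul (by positivity), mul_comm α,
      Real.div_rpow (NNReal.coe_nonneg s) hω.le, Real.rpow_neg hω.le, div_eq_mul_inv]
  have h2 : ∫⁻ ω, ENNReal.ofReal (A 1 ω ^ (-((n : ℝ) * α))) ∂P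
      = ENNReal.ofReal (1 / α * Real.Gamma n / Real.Gamma (n * α)) := by
    rw [ENNReal.ofReal_div_of_pos hΓ, ENNReal.eq_div_iff (by simpa using hΓ) ENNReal.ofReal_ne_top,
      hneg, mul_div_cancel_right₀ _ hα.ne']
  rw [h1, h2, ← ENNReal.ofReal_mul (by positivity), fracCoeff]
  congr 1
  -- What remains is Γ(n)/(α Γ(nα)) = n!/Γ(nα+1), from Γ(x+1) = xΓ(x).
  obtain ⟨m, rfl⟩ := Nat.exists_eq_succ_of_ne_zero hn.ne'
  rw [Real.Gamma_add_one hq.ne', Nat.factorial_succ, Nat.succ_eq_add_one]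
  have h3 : Real.Gamma ((m + 1 : ℕ) : ℝ) = m.factorial := by
    rw [Nat.cast_add_one, Real.Gamma_nat_eq_factorial]
  rw [h3]
  push_cast
  have : (m : ℝ) + 1 ≠ 0 := by positivity
  field_simp

/-- The first passage time of a stable subordinator has the Mittag-Leffler law. -/
theorem IsStableSubordinator.firstPassage_exp (hα : 0 < α) (hA : IsStableSubordinator α A P)
    (s : ℝ≥0) (z : ℂ) :
    Integrable (fun ω => Complex.exp (z * firstPassage A s ω)) P ∧
      ∫ ω, Complex.exp (z * firstPassage A s ω) ∂P = fracExp α z s :=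
  integrable_exp_mul_of_moments
    (aemeasurable_firstPassage hA.subordinator.levy.measurable hA.subordinator.mono hA.unbounded s)
    (fracCoeff_nonneg hα s) (fun _ hx => summable_pow_mul_fracCoeff hα hx s)
    (hA.lintegral_firstPassage_pow hα s) z

end FirstPassage

/-! ### The symbol and the fractional Skellam process -/

theorem symbol_ofReal (k : ℕ) (lam mu : ℕ → ℝ) (r : ℝ) :
    symbol k lam mu (r : ℂ) = (symbol k lam mu r : ℝ) := by
  simp [symbol]

/-- The rates are positive and Re u^j ≤ |u|^j for exponents of either sign. This makes g(|u|) the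
exponent in the dominating function. -/
theorem re_symbol_le {k : ℕ} {lam mu : ℕ → ℝ} (hlam : ∀ j ∈ Finset.Icc 1 k, 0 < lam j)
    (hmu : ∀ j ∈ Finset.Icc 1 k, 0 < mu j) (u : ℂ) :
    (symbol k lam mu u).re ≤ symbol k lam mu ‖u‖ := by
  rw [symbol, symbol, Complex.re_sum]
  refine Finset.sum_le_sum fun j hj => ?_
  have h1 : (u ^ j).re ≤ ‖u‖ ^ j := (Complex.re_le_norm _).trans_eq (norm_pow u j)
  have h2 : (u ^ (-(j : ℤ))).re ≤ ‖u‖ ^ (-(j : ℤ)) :=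
    (Complex.re_le_norm _).trans_eq (norm_zpow u _)
  have h3 := (hlam j hj).le
  have h4 := (hmu j hj).le
  simp only [Complex.add_re, Complex.coe_algebraMap, Complex.re_ofReal_mul, Complex.sub_re,
    Complex.one_re, RCLike.ofReal_real_eq_id, id_eq]
  gcongr

section

variable {Ω : Type*} [MeasurableSpace Ω] {P : Measure Ω}

theorem lintegral_ofReal_zpow {X : Ω → ℤ} {r c : ℝ} (hr : 0 < r)
    (hi : Integrable (fun ω => (r : ℂ) ^ X ω) P) (h : ∫ ω, (r : ℂ) ^ X ω ∂P = c) :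
    ∫⁻ ω, ENNReal.ofReal (r ^ X ω) ∂P = ENNReal.ofReal c := by
  have h1 : ∀ ω, (r : ℂ) ^ X ω = ((r ^ X ω : ℝ) : ℂ) := fun ω => by push_cast; rfl
  simp only [h1] at hi h
  rw [integral_complex_ofReal, Complex.ofReal_inj] at h
  have hi' : Integrable (fun ω => r ^ X ω) P := by
    simpa only [RCLike.re_eq_complex_re, Complex.ofReal_re] using hi.re
  rw [← h, ofReal_integral_eq_lintegral_ofReal hi' (ae_of_all _ fun ω => (zpow_pos hr _).le)]

theorem enorm_zpow_eq (u : ℂ) (n : ℤ) : ‖u ^ n‖ₑ = ENNReal.ofReal (‖u‖ ^ n) := by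
  rw [← ofReal_norm, norm_zpow]

theorem aestronglyMeasurable_zpow {𝕜 : Type*} [RCLike 𝕜] {X : Ω → ℤ} (hX : AEMeasurable X P)
    (u : 𝕜) : AEStronglyMeasurable (fun ω => u ^ X ω) P := by
  have hm : Measurable fun n : ℤ => u ^ n := measurable_from_top
  exact (hm.comp_aemeasurable hX).aestronglyMeasurable

/-- An integer-valued process with right-continuous paths and the one-dimensional generating
functions `E_α (g u * s ^ α)`. -/
structure HasFracLaw (α : ℝ) (g : ℂ → ℂ) (X : ℝ≥0 → Ω → ℤ) (P : Measure Ω) : Prop where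
  aemeasurable : ∀ s, AEMeasurable (X s) P
  rightCts : ∀ᵐ ω ∂P, ∀ s, ContinuousWithinAt (fun s => X s ω) (Set.Ici s) s
  integrable : ∀ (s : ℝ≥0) (u : ℂ), u ≠ 0 → Integrable (fun ω => u ^ X s ω) P
  integral : ∀ (s : ℝ≥0) (u : ℂ), u ≠ 0 → ∫ ω, u ^ X s ω ∂P = fracExp α (g u) s

variable [IsProbabilityMeasure P] {k : ℕ} {lam mu : ℕ → ℝ} {M₁ M₂ : ℝ≥0 → Ω → ℕ}

theorem hasFracLaw_skellam (hM₁ : IsGCP k lam M₁ P) (hM₂ : IsGCP k mu M₂ P)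
    (hM : IndepFun (fun ω t => M₁ t ω) (fun ω t => M₂ t ω) P) :
    HasFracLaw 1 (symbol k lam mu) (skellam M₁ M₂) P where
  aemeasurable s := ((hM₁.levy.measurable s).sub (hM₂.levy.measurable s)).aemeasurable
  rightCts := by
    filter_upwards [hM₁.levy.cadlag, hM₂.levy.cadlag] with ω h1 h2 s
    exact (h1 s).1.sub (h2 s).1
  integrable s _ hu := (skellam_generatingFunction hM₁ hM₂ hM hu s).1
  integral s u hu := by rw [(skellam_generatingFunction hM₁ hM₂ hM hu s).2, fracExp_one]

/-- Conditioning on the passage time Y_s turns exp(g(u) y) into E exp(g(u) Y_s) = E_α(g(u) s^α);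
integrability comes from the same computation at |u|. -/
theorem HasFracLaw.comp_firstPassage {α : ℝ} (hα : 0 < α) {S : ℝ≥0 → Ω → ℤ}
    (hS : HasFracLaw 1 (symbol k lam mu) S P) {A : ℝ≥0 → Ω → ℝ}
    (hA : IsStableSubordinator α A P)
    (hSY : IndepFun (fun ω t => S t ω) (fun ω t => firstPassage A t ω) P) :
    HasFracLaw α (symbol k lam mu) (fun s ω => S (firstPassage A s ω) ω) P := by
  have hYm := aemeasurable_firstPassage hA.subordinator.levy.measurable hA.subordinator.mono
    hA.unbounded
  have hind : ∀ s t, IndepFun (S t) (firstPassage A s) P := fun s t =>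
    hSY.comp (measurable_pi_apply t) (measurable_pi_apply s)
  have hint : ∀ s, ∀ u : ℂ, u ≠ 0 →
      Integrable (fun ω => u ^ S (firstPassage A s ω) ω) P := by
    intro s u hu
    have hr : 0 < ‖u‖ := norm_pos_iff.2 hu
    have hX := (map_randomTime hS.aemeasurable hS.rightCts (hYm s) (hind s)).1
    refine ⟨aestronglyMeasurable_zpow hX u, ?_⟩
    rw [hasFiniteIntegral_iff_enorm]
    simp only [enorm_zpow_eq]
    rw [lintegral_randomTime hS.aemeasurable hS.rightCts (hYm s) (hind s)
      fun n => ENNReal.ofReal (‖u‖ ^ n)]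
    have h1 : ∀ t : ℝ≥0, ∫⁻ ω, ENNReal.ofReal (‖u‖ ^ S t ω) ∂P
        = ‖Complex.exp ((symbol k lam mu ‖u‖ : ℝ) * (t : ℂ))‖ₑ := by
      intro t
      have hu' : ((‖u‖ : ℝ) : ℂ) ≠ 0 := by exact_mod_cast hr.ne'
      rw [lintegral_ofReal_zpow (c := Real.exp (symbol k lam mu ‖u‖ * t)) hr
        (hS.integrable t _ hu')]
      · rw [← ofReal_norm, Complex.norm_exp]
        congr 2
        simp
      · rw [hS.integral t _ hu', fracExp_one, symbol_ofReal]
        push_cast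
        rfl
    simp only [h1]
    rw [lintegral_map' (by fun_prop) (hYm s)]
    exact (hA.firstPassage_exp hα s _).1.2
  refine ⟨fun s => (map_randomTime hS.aemeasurable hS.rightCts (hYm s) (hind s)).1, ?_, hint,
    fun s u hu => ?_⟩
  · filter_upwards [hS.rightCts, hA.unbounded] with ω h1 h2 s
    -- Monotonicity of the inner path makes it approach its value from the right, where the outer
    -- path is continuous.
    exact (h1 _).comp (firstPassage_rightCts h2 s) fun s' hs' => firstPassage_mono h2 hs'
  · rw [integral_randomTime hS.aemeasurable hS.rightCts (hYm s) (hind s) (fun n => u ^ n)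
      (hint s u hu), ← (hA.firstPassage_exp hα s _).2]
    simp only [hS.integral _ u hu, fracExp_one]
    exact integral_map (hYm s) (by fun_prop)

theorem IsStableSubordinator.isMixture {α : ℝ} (hα : 0 < α) {A : ℝ≥0 → Ω → ℝ}
    (hA : IsStableSubordinator α A P) : IsMixture α := by
  intro s
  have hYm := aemeasurable_firstPassage hA.subordinator.levy.measurable hA.subordinator.mono
    hA.unbounded s
  refine ⟨P.map (firstPassage A s), Measure.isProbabilityMeasure_map hYm, fun z => ?_⟩
  obtain ⟨h1, h2⟩ := hA.firstPassage_exp hα s z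
  have hm : AEStronglyMeasurable (fun y : ℝ≥0 => Complex.exp (z * y))
      (P.map (firstPassage A s)) := by fun_prop
  exact ⟨(integrable_map_measure hm hYm).2 h1, by rw [integral_map hYm hm, h2]⟩

end

end TimeChangedSkellam

/-! ### The generating function of the time-changed process -/

theorem mainTheorem1 {Ω : Type*} [MeasurableSpace Ω] (P : Measure Ω) [IsProbabilityMeasure P]
    (α : ℝ) (hα0 : 0 < α) (hα1 : α ≤ 1) (k : ℕ) (hk : 1 ≤ k) (lam mu : ℕ → ℝ)
    (hlam : ∀ j ∈ Finset.Icc 1 k, 0 < lam j) (hmu : ∀ j ∈ Finset.Icc 1 k, 0 < mu j)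
    (M₁ M₂ : ℝ≥0 → Ω → ℕ) (A D : ℝ≥0 → Ω → ℝ)
    -- two independent generalized counting processes
    (hM₁ : TimeChangedSkellam.IsGCP k lam M₁ P) (hM₂ : TimeChangedSkellam.IsGCP k mu M₂ P)
    (hM : IndepFun (fun ω t => M₁ t ω) (fun ω t => M₂ t ω) P)
    -- for `α < 1`, an inverse stable subordinator, independent of the Skellam process
    (hA : α < 1 → TimeChangedSkellam.IsStableSubordinator α A P)
    (hSY : α < 1 → IndepFun (fun ω t => TimeChangedSkellam.skellam M₁ M₂ t ω)
      (fun ω t => TimeChangedSkellam.firstPassage A t ω) P)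
    -- a subordinator with finite moments, independent of the fractional Skellam process
    (hD : TimeChangedSkellam.IsSubordinator D P)
    (hDmom : ∀ (t : ℝ≥0) (r : ℝ), 0 < r → Integrable (fun ω => D t ω ^ r) P)
    (hSD : IndepFun
      (fun ω t => TimeChangedSkellam.gfsp α (TimeChangedSkellam.skellam M₁ M₂) A t ω)
      (fun ω t => D t ω) P)
    (Z : ℝ≥0 → Ω → ℤ)
    (hZ : Z = TimeChangedSkellam.timeChange
      (TimeChangedSkellam.gfsp α (TimeChangedSkellam.skellam M₁ M₂) A) D)
    (t : ℝ≥0) :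
    -- complex `u`: the identity holds whenever both of its sides exist
    (∀ u : ℂ, u ≠ 0 → ‖u‖ ≤ 1 → Integrable (fun ω => u ^ Z t ω) P →
      ∀ s : ℂ, Tendsto (fun N => ∑ n ∈ Finset.range N,
          TimeChangedSkellam.symbol k lam mu u ^ n
            * ((TimeChangedSkellam.coeff P α D t n : ℝ) : ℂ)) atTop (𝓝 s) →
        ∫ ω, u ^ Z t ω ∂P = s) ∧
    -- existence of the left-hand side
    (∀ u : ℂ, ‖u‖ = 1 → Integrable (fun ω => u ^ Z t ω) P) ∧
    (∀ r : ℝ, 0 < r → r ≤ 1 → TimeChangedSkellam.symbol k lam mu r ≤ 0 →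
      Integrable (fun ω => r ^ Z t ω) P) ∧
    -- real `u` with a nonnegative symbol: the identity holds in `[0, ∞]`
    (∀ r : ℝ, 0 < r → r ≤ 1 → 0 ≤ TimeChangedSkellam.symbol k lam mu r →
      ∫⁻ ω, ENNReal.ofReal (r ^ Z t ω) ∂P
        = ∑' n : ℕ, ENNReal.ofReal (TimeChangedSkellam.symbol k lam mu r ^ n
            * TimeChangedSkellam.coeff P α D t n)) := by
  subst hZ
  set g : ℂ → ℂ := TimeChangedSkellam.symbol k lam mu with hg
  set X := TimeChangedSkellam.gfsp α (TimeChangedSkellam.skellam M₁ M₂) A with hX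
  have hS := TimeChangedSkellam.hasFracLaw_skellam hM₁ hM₂ hM
  -- The only place where α < 1 and α = 1 differ; for α = 1 the mixing measure is a Dirac mass.
  obtain ⟨hlaw, hmix⟩ : TimeChangedSkellam.HasFracLaw α g X P ∧ TimeChangedSkellam.IsMixture α := by
    rcases hα1.lt_or_eq with hlt | rfl
    · have hXe : X = fun s ω => TimeChangedSkellam.skellam M₁ M₂
          (TimeChangedSkellam.firstPassage A s ω) ω := by
        funext s ω
        simp [hX, TimeChangedSkellam.gfsp, hlt]
      rw [hXe]
      exact ⟨hS.comp_firstPassage hα0 (hA hlt) (hSY hlt), (hA hlt).isMixture hα0⟩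
    · have hXe : X = TimeChangedSkellam.skellam M₁ M₂ := by
        funext s ω
        simp [hX, TimeChangedSkellam.gfsp]
      rw [hXe]
      exact ⟨hS, TimeChangedSkellam.IsMixture.one⟩
  have hDm := hD.levy.measurable t
  set T : Ω → ℝ≥0 := fun ω => (D t ω).toNNReal with hT
  have hTm : AEMeasurable T P := hDm.real_toNNReal.aemeasurable
  have hTD : ∀ᵐ ω ∂P, (T ω : ℝ) = D t ω := by
    filter_upwards [hD.nonneg] with ω hω
    exact Real.coe_toNNReal _ (hω t)
  set ρ := P.map T with hρ
  have : IsProbabilityMeasure ρ := Measure.isProbabilityMeasure_map hTm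
  have hind : ∀ s, IndepFun (X s) T P := fun s =>
    hSD.comp (measurable_pi_apply s) (measurable_real_toNNReal.comp (measurable_pi_apply t))
  have hZm : AEMeasurable (TimeChangedSkellam.timeChange X D t) P :=
    (TimeChangedSkellam.map_randomTime hlaw.aemeasurable hlaw.rightCts hTm hind).1
  have hDint : ∀ n : ℕ, Integrable (fun ω => D t ω ^ ((n : ℝ) * α)) P := by
    intro n
    -- The moment hypothesis covers positive exponents only; at n = 0 the integrand is 1.
    rcases Nat.eq_zero_or_pos n with rfl | hn
    · simp
    · exact hDmom t _ (by positivity)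
  have hcm : ∀ n, AEStronglyMeasurable (fun s => TimeChangedSkellam.fracCoeff α s n) ρ := fun n =>
    (TimeChangedSkellam.measurable_fracCoeff α n).aestronglyMeasurable
  have hcD : ∀ n, ∀ᵐ ω ∂P, TimeChangedSkellam.fracCoeff α (T ω) n
      = D t ω ^ ((n : ℝ) * α) / Real.Gamma ((n : ℝ) * α + 1) := fun n => by
    filter_upwards [hTD] with ω hω
    rw [TimeChangedSkellam.fracCoeff, hω]
  have hcint : ∀ n, Integrable (fun s => TimeChangedSkellam.fracCoeff α s n) ρ := fun n =>
    (integrable_map_measure (hcm n) hTm).2 (((hDint n).div_const _).congr (by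
      filter_upwards [hcD n] with ω hω using hω.symm))
  have hcoeff : ∀ n, ∫ s, TimeChangedSkellam.fracCoeff α s n ∂ρ
      = TimeChangedSkellam.coeff P α D t n := fun n => by
    rw [integral_map hTm (hcm n), integral_congr_ae (hcD n), integral_div,
      TimeChangedSkellam.coeff]
  have hreal : ∀ r : ℝ, 0 < r →
      ∫⁻ ω, ENNReal.ofReal (r ^ TimeChangedSkellam.timeChange X D t ω) ∂P
        = ∫⁻ s, ENNReal.ofReal
            (TimeChangedSkellam.fracExp α (TimeChangedSkellam.symbol k lam mu r) s) ∂ρ := by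
    intro r hr
    have hr' : (r : ℂ) ≠ 0 := by exact_mod_cast hr.ne'
    refine (TimeChangedSkellam.lintegral_randomTime hlaw.aemeasurable hlaw.rightCts hTm hind
      fun n => ENNReal.ofReal (r ^ n)).trans (lintegral_congr fun s => ?_)
    refine TimeChangedSkellam.lintegral_ofReal_zpow hr (hlaw.integrable s _ hr') ?_
    rw [hlaw.integral s _ hr', hg, TimeChangedSkellam.symbol_ofReal,
      TimeChangedSkellam.fracExp_ofReal]
  refine ⟨fun u hu hu1 hint l hl => ?_, fun u hu => ?_, fun r hr _ hg0 => ?_, fun r hr _ hg0 => ?_⟩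
  -- By `hreal` at |u|, integrability of E_α(g(|u|) s^α) under ρ is the hypothesis E|u|^Z < ∞.
  · have hfin : Integrable (fun s => TimeChangedSkellam.fracExp α
        (TimeChangedSkellam.symbol k lam mu ‖u‖) s) ρ := by
      refine ⟨(TimeChangedSkellam.measurable_fracExp hα0 _).aestronglyMeasurable, ?_⟩
      rw [hasFiniteIntegral_iff_ofReal (ae_of_all _ fun s => hmix.fracExp_nonneg _ s),
        ← hreal _ (norm_pos_iff.2 hu)]
      simpa only [hasFiniteIntegral_iff_enorm, TimeChangedSkellam.enorm_zpow_eq] using hint.2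
    refine (TimeChangedSkellam.integral_randomTime hlaw.aemeasurable hlaw.rightCts hTm hind
      (fun n => u ^ n) hint).trans ?_
    simp only [hlaw.integral _ u hu]
    refine hmix.integral_fracExp_eq_of_tendsto hα0 hcint
      (TimeChangedSkellam.re_symbol_le hlam hmu u) hfin ?_
    simpa only [hcoeff] using hl
  · refine Integrable.of_bound (TimeChangedSkellam.aestronglyMeasurable_zpow hZm u) 1
      (ae_of_all _ fun ω => ?_)
    rw [norm_zpow, hu, one_zpow]
  · refine ⟨TimeChangedSkellam.aestronglyMeasurable_zpow hZm r, ?_⟩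
    rw [hasFiniteIntegral_iff_ofReal (ae_of_all _ fun ω => (zpow_pos hr _).le), hreal r hr]
    calc ∫⁻ s, ENNReal.ofReal
          (TimeChangedSkellam.fracExp α (TimeChangedSkellam.symbol k lam mu r) s) ∂ρ
        ≤ ∫⁻ _, 1 ∂ρ := lintegral_mono fun s =>
          ENNReal.ofReal_le_one.2 (hmix.fracExp_le_one hg0 s)
      _ < ⊤ := by simp
  · have hnn : ∀ n s, 0 ≤ TimeChangedSkellam.symbol k lam mu r ^ n
        * TimeChangedSkellam.fracCoeff α s n := fun n s =>
      mul_nonneg (pow_nonneg hg0 n) (TimeChangedSkellam.fracCoeff_nonneg hα0 s n)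
    rw [hreal r hr]
    have hsum : ∀ s, ENNReal.ofReal
        (TimeChangedSkellam.fracExp α (TimeChangedSkellam.symbol k lam mu r) s)
        = ∑' n, ENNReal.ofReal (TimeChangedSkellam.symbol k lam mu r ^ n
          * TimeChangedSkellam.fracCoeff α s n) := fun s =>
      ENNReal.ofReal_tsum_of_nonneg (fun n => hnn n s)
        (TimeChangedSkellam.summable_pow_mul_fracCoeff hα0 hg0 s)
    simp only [hsum]
    -- All terms are nonnegative, so Tonelli gives equality in [0, ∞].
    rw [lintegral_tsum fun n =>
      ((TimeChangedSkellam.measurable_fracCoeff α n).const_mul _).ennreal_ofReal.aemeasurable]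
    refine tsum_congr fun n => ?_
    rw [← hcoeff, ← integral_const_mul,
      ofReal_integral_eq_lintegral_ofReal ((hcint n).const_mul _) (ae_of_all _ (hnn n))]
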